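/- **Syntax.** The arities are the finite sequences $(\alpha_1,\dots,\alpha_n)$ ($n\ge 0$) of arities. The arity $()$ has order $0$, and for $n\ge 1$ the order of $(\alpha_1,\dots,\alpha_n)$ is $1+\max_i \mathrm{order}(\alpha_i)$. Every variable and constant has an arity. If $z$ is a variable or constant of arity $(\alpha_1,\dots,\alpha_n)$, the objects with head $z$ are $z[F_1,\dots,F_n]$, where $F_i$ is an $\alpha_i$-ary abstraction; a $(\beta_1,\dots,\beta_r)$-ary abstraction is $[x_1,\dots,x_r]M$ with $M$ an object and $x_j$ a bound variable of arity $\beta_j$. A base kind is $\mathbf{Type}$ or $\mathrm{El}(A)$, $A$ an object. An $\alpha$-ary kind is $(\Delta)T$, where $T$ is a base kind and $\Delta$ a context of arity $\alpha$; a context of arity $(\alpha_1,\dots,\alpha_n)$ is $x_1:K_1,\dots,x_n:K_n$ with distinct $x_i$, where $x_i$ and $K_i$ have arity $\alpha_i$ and $x_i$ may occur in later entries (and in $T$). The order of a kind or a context is that of its arity. Expressions are taken up to renaming of bound variables. Instantiation of an $\alpha$-ary abstraction $F=[t_1,\dots,t_n]P$ for an $\alpha$-ary variable $x$ is defined by recursion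 on $\alpha$ and then on the object: $\{F/x\}(z[\vec G])=z[\{F/x\}\vec G]$ for $z\ne x$, and $\{F/x\}(x[G_1,\dots,G_n])=\{\{F/x\}G_1/t_1\}\cdots\{\{F/x\}G_n/t_n\}P$ ($t_i$ not free in the $G_j$); it extends to kinds, contexts and judgement bodies. $\{\vec F/\Delta\}$ instantiates a sequence $\vec F$ for the variables of $\Delta$. **Judgements.** The primitive judgements are $\Gamma\ \mathrm{valid}$, $\Gamma\vdash M:T$ and $\Gamma\vdash M=N:T$ ($T$ a base kind); we write $\Gamma\vdash J$ for any of them. Further judgements abbreviate finite sets of these, and are derivable when all the members are: $\Gamma\Vdash(\Delta)\mathbf{Type}\ \mathrm{kind}$ is $\Gamma,\Delta\ \mathrm{valid}$; $\Gamma\Vdash(\Delta)\mathrm{El}(A)\ \mathrm{kind}$ is $\Gamma,\Delta\vdash A:\mathbf{Type}$; $\Gamma\Vdash[\vec x]M:(\Delta)T$ is $\Gamma,\Delta\vdash M:T$; $\Gamma\Vdash[\vec x]M=[\vec x]N:(\Delta)T$ is $\Gamma,\Delta\vdash M=N:T$ (with $\vec x$ the variables of $\Delta$); $\Gamma\Vdash\vec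 F::\Delta$ (resp. $\Gamma\Vdash\vec F=\vec G::\Delta$), for $\Delta=x_1:K_1,\dots,x_n:K_n$, consists of $\Gamma\ \mathrm{valid}$ and all $\Gamma\Vdash F_i:\{F_1,\dots,F_{i-1}/x_1,\dots,x_{i-1}\}K_i$ (resp. $\Gamma\Vdash F_i=G_i:\{F_1,\dots,F_{i-1}/x_1,\dots,x_{i-1}\}K_i$). Equality of kinds $\Gamma\Vdash(\Delta)T=(\Delta')T'$, with $\Delta=x_1:K_1,\dots,x_n:K_n$ and $\Delta'=x_1:K'_1,\dots,x_n:K'_n$ of the same arity, consists of $\Gamma\ \mathrm{valid}$, all $\Gamma,x_1:K_1,\dots,x_{i-1}:K_{i-1}\Vdash K_i=K'_i$, and $\Gamma,\Delta\Vdash T=T'$, where $\Gamma\Vdash\mathbf{Type}=\mathbf{Type}$ is $\Gamma\ \mathrm{valid}$, $\Gamma\Vdash\mathrm{El}(A)=\mathrm{El}(B)$ is $\Gamma\vdash A=B:\mathbf{Type}$, and $\mathbf{Type}$ is never equal to an $\mathrm{El}(A)$. **Rules.** A type theory specification $\mathcal T$ is a set of constant declarations $c:K$ ($K$ closed, of the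 arity of $c$) and equation declarations $(\Delta)(M=N:T)$ (closed). The order of a declaration is that of $K$, resp. of $\Delta$. The derivable judgements are generated by: the empty context is valid; if $\Gamma\Vdash K\ \mathrm{kind}$ then $\Gamma,x:K$ is valid ($x$ new); for $z:(\Delta)T$ in $\Gamma$ or in $\mathcal T$, if $\Gamma\Vdash\vec F::\Delta$ then $\Gamma\vdash z\vec F:\{\vec F/\Delta\}T$, and if $\Gamma\Vdash\vec F=\vec G::\Delta$ then $\Gamma\vdash z\vec F=z\vec G:\{\vec F/\Delta\}T$; for $(\Delta)(M=N:T)$ in $\mathcal T$, if $\Gamma\Vdash\vec F::\Delta$ then $\Gamma\vdash\{\vec F/\Delta\}M=\{\vec F/\Delta\}N:\{\vec F/\Delta\}T$; reflexivity ($M=M:T$ if $M:T$), symmetry and transitivity of equality; and if $\Gamma\vdash A=B:\mathbf{Type}$ then $\Gamma\vdash M:\mathrm{El}(A)$ implies $\Gamma\vdash M:\mathrm{El}(B)$ and $\Gamma\vdash M=N:\mathrm{El}(A)$ implies $\Gamma\vdash M=N:\mathrm{El}(B)$. $\mathcal T$ is $n$-good if, for every context $\Gamma$ of order $\le n$, $\Gamma\vdash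 M=N:T$ implies $\Gamma\vdash M:T$ and $\Gamma\vdash N:T$. **Theorem.** Let $\mathcal T$ be an $n$-good type theory specification all of whose declarations have order $\le n+1$, and let $\Gamma,x:K,\Delta$ be a context of order $\le n$. 1. (Cut) If $\Gamma,x:K,\Delta\vdash J$ and $\Gamma\Vdash F:K$, then $\Gamma,\{F/x\}\Delta\vdash\{F/x\}J$. 2. (Functionality) If $\Gamma,x:K,\Delta\vdash M:T$ and $\Gamma\Vdash F=G:K$, then $\Gamma,\{F/x\}\Delta\vdash\{F/x\}M=\{G/x\}M:\{F/x\}T$. 3. (Context Conversion) If $\Gamma,x:K,\Delta\vdash J$ and $\Gamma\Vdash K=K'$, then $\Gamma,x:K',\Delta\vdash J$. -/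

import Mathlib

/-!  The lambda-free logical framework TF.

Expressions are identified up to renaming of bound variables, so they are represented by well-scoped
de Bruijn syntax: a scope is the list of the arities of the variables that may occur free, the most
recently declared variable first, and every expression is indexed by its scope. -/

namespace TF

universe u

/-- Arities: `base` is the arity `()`, and `cons α (β₁, …, βₙ)` is the arity `(α, β₁, …, βₙ)`. Thus
an arity is a finite sequence of arities. -/
inductive Arity : Type
  | base : Arity
  | cons : Arity → Arity → Arity

/-- The order of an arity: `()` has order `0`, and `(α₁, …, αₙ)` with `n ≥ 1` has order
`1 + max (order αᵢ)`. -/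
def Arity.order : Arity → ℕ
  | .base => 0
  | .cons α β => max (α.order + 1) β.order

/-- A scope: the arities of the available variables, the most recent one first. -/
abbrev Scope : Type := List Arity

/-- The order of a context whose variables have the arities listed in the scope. -/
def Scope.order : Scope → ℕ
  | [] => 0
  | α :: s => max (α.order + 1) (Scope.order s)

/-- `ext s (α₁, …, αₙ)` is the scope `s` extended by `n` new variables `x₁, …, xₙ`, declared in this
order, where `xᵢ` has arity `αᵢ`. -/
def ext (s : Scope) : Arity → Scope
  | .base => s
  | .cons α β => ext (α :: s) β

/-- `Var s α`: the variables of arity `α` in the scope `s`. -/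
inductive Var : Scope → Arity → Type
  | here {s : Scope} {α : Arity} : Var (α :: s) α
  | there {s : Scope} {α β : Arity} : Var s α → Var (β :: s) α

/-! ### Objects, abstractions, abstraction sequences

`C` is the type of constants, and `ar c` is the arity of the constant `c`. -/

mutual
/-- The objects `z F⃗`, where `z` is an `α`-ary variable or constant and `F⃗` an `α`-ary abstraction
sequence. -/
inductive Obj {C : Type u} (ar : C → Arity) : Scope → Type u
  | var {s : Scope} {α : Arity} : Var s α → Args ar s α → Obj ar s
  | const {s : Scope} (c : C) : Args ar s (ar c) → Obj ar s
/-- The abstraction sequences `⟨F₁, …, Fₙ⟩` of a given arity `(α₁, …, αₙ)`: here `Fᵢ` is an `αᵢ`-ary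
abstraction, that is, an object in the scope extended by the bound variables. -/
inductive Args {C : Type u} (ar : C → Arity) : Scope → Arity → Type u
  | nil {s : Scope} : Args ar s .base
  | cons {s : Scope} {α β : Arity} : Obj ar (ext s α) → Args ar s β → Args ar s (.cons α β)
end

/-- The `α`-ary abstractions `[x₁, …, xₙ]M`. -/
abbrev Abs {C : Type u} (ar : C → Arity) (s : Scope) (α : Arity) : Type u := Obj ar (ext s α)

/-! ### Renaming of variables -/

/-- Arity-preserving maps of variables. -/
abbrev Ren (s t : Scope) : Type := ∀ α : Arity, Var s α → Var t α

/-- A renaming under one more bound variable. -/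
def Ren.lift {s s' : Scope} (ρ : Ren s s') (β : Arity) : Ren (β :: s) (β :: s')
  | _, .here => .here
  | _, .there x => .there (ρ _ x)

/-- A renaming under a sequence of bound variables. -/
def Ren.ext {s s' : Scope} (ρ : Ren s s') : (β : Arity) → Ren (TF.ext s β) (TF.ext s' β)
  | .base => ρ
  | .cons α β => Ren.ext (ρ.lift α) β

/-- Weakening by one variable. -/
def Ren.wk {s : Scope} (β : Arity) : Ren s (β :: s) := fun _ x => .there x

/-- The renaming that views a closed expression in an arbitrary scope. -/
def Ren.closed (s : Scope) : Ren [] s := fun _ x => nomatch x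

mutual
/-- Renaming in an object. -/
def Obj.rename {C : Type u} {ar : C → Arity} {s s' : Scope} (ρ : Ren s s') : Obj ar s → Obj ar s'
  | .var x G => .var (ρ _ x) (G.rename ρ)
  | .const c G => .const c (G.rename ρ)
/-- Renaming in an abstraction sequence. -/
def Args.rename {C : Type u} {ar : C → Arity} {s s' : Scope} {α : Arity} (ρ : Ren s s') :
    Args ar s α → Args ar s' α
  | .nil => .nil
  | .cons (α := α) F G => .cons (F.rename (ρ.ext α)) (G.rename ρ)
end

/-! ### Instantiation -/

/-- What happens to a `β`-ary variable when an `α`-ary variable is instantiated: either it stays a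
variable (of the new scope), or it is the instantiated variable and an abstraction replaces it. -/
inductive Img {C : Type u} (ar : C → Arity) (α : Arity) (s : Scope) : Arity → Type u
  | keep {β : Arity} : Var s β → Img ar α s β
  | repl : Abs ar s α → Img ar α s α

/-- The action of the instantiation of an `α`-ary variable on the variables of a scope. -/
abbrev Inst {C : Type u} (ar : C → Arity) (α : Arity) (s t : Scope) : Type u :=
  ∀ β : Arity, Var s β → Img ar α t β

/-- `{F/x}` for the most recent variable `x` of the scope `α :: s`. -/
def Inst.single {C : Type u} {ar : C → Arity} {α : Arity} {s : Scope} (F : Abs ar s α) :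
    Inst ar α (α :: s) s
  | _, .here => .repl F
  | _, .there y => .keep y

/-- The image of a variable, in a scope with one more variable. -/
def Img.wk {C : Type u} {ar : C → Arity} {α β : Arity} {s : Scope} (γ : Arity) :
    Img ar α s β → Img ar α (γ :: s) β
  | .keep y => .keep (.there y)
  | .repl F => .repl (F.rename ((Ren.wk γ).ext α))

/-- An instantiation under one more bound variable. -/
def Inst.lift {C : Type u} {ar : C → Arity} {α : Arity} {s s' : Scope} (σ : Inst ar α s s')
    (γ : Arity) : Inst ar α (γ :: s) (γ :: s')
  | _, .here => .keep .here
  | _, .there x => (σ _ x).wk γ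

/-- An instantiation under a sequence of bound variables. -/
def Inst.ext {C : Type u} {ar : C → Arity} {α : Arity} {s s' : Scope} (σ : Inst ar α s s') :
    (γ : Arity) → Inst ar α (TF.ext s γ) (TF.ext s' γ)
  | .base => σ
  | .cons γ δ => Inst.ext (σ.lift γ) δ

/-- The new head applied to the (already instantiated) arguments. The parameter `hd` says what an
abstraction `[t₁, …, tₙ]P` in head position does with its arguments `G₁, …, Gₙ`. -/
def Img.app {C : Type u} {ar : C → Arity} {α β : Arity} {s : Scope}
    (hd : Args ar s α → Abs ar s α → Obj ar s) : Img ar α s β → Args ar s β → Obj ar s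
  | .keep y, G => .var y G
  | .repl F, G => hd G F

mutual
/-- Recursion on the object in the definition of instantiation, relative to `hd`. -/
def Obj.instWith {C : Type u} {ar : C → Arity} {α : Arity}
    (hd : ∀ s : Scope, Args ar s α → Abs ar s α → Obj ar s) {s s' : Scope}
    (σ : Inst ar α s s') : Obj ar s → Obj ar s'
  | .var x G => (σ _ x).app (hd s') (G.instWith hd σ)
  | .const c G => .const c (G.instWith hd σ)
/-- Recursion on the abstraction sequence in the definition of instantiation, relative to `hd`. -/
def Args.instWith {C : Type u} {ar : C → Arity} {α β : Arity}
    (hd : ∀ s : Scope, Args ar s α → Abs ar s α → Obj ar s) {s s' : Scope}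
    (σ : Inst ar α s s') : Args ar s β → Args ar s' β
  | .nil => .nil
  | .cons (α := γ) F G => .cons (F.instWith hd (σ.ext γ)) (G.instWith hd σ)
end

/-- `instSeq (α₁, …, αₙ) s ⟨G₁, …, Gₙ⟩ P` is `{G₁/t₁} ⋯ {Gₙ/tₙ} P`, where `tᵢ` are the last `n`
variables of the scope of `P`, which do not occur free in the `Gⱼ`. Together with `Obj.instWith` this
is the recursion on the arity in the definition of instantiation. -/
def instSeq {C : Type u} {ar : C → Arity} :
    (α : Arity) → (s : Scope) → Args ar s α → Abs ar s α → Obj ar s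
  | .base, _, _, P => P
  | .cons α β, s, .cons F G, P =>
      (instSeq β (α :: s) (G.rename (Ren.wk α)) P).instWith (instSeq α) (Inst.single F)

/-- Instantiation `{F/x}M` of an abstraction for a variable in an object. -/
def Obj.inst {C : Type u} {ar : C → Arity} {α : Arity} {s s' : Scope} (σ : Inst ar α s s')
    (M : Obj ar s) : Obj ar s' :=
  M.instWith (instSeq α) σ

/-! ### Kinds and contexts -/

/-- Base kinds: `Type` and `El A`. -/
inductive BKind {C : Type u} (ar : C → Arity) (s : Scope) : Type u
  | type : BKind ar s
  | El : Obj ar s → BKind ar s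

mutual
/-- The `α`-ary product kinds `(Δ)T`. -/
inductive Kind {C : Type u} (ar : C → Arity) : Scope → Arity → Type u
  | mk {s : Scope} {α : Arity} : Tel ar s α → BKind ar (ext s α) → Kind ar s α
/-- The `α`-ary context extensions `x₁ : K₁, …, xₙ : Kₙ` over a scope; `cons K Δ` is `x : K, Δ`. -/
inductive Tel {C : Type u} (ar : C → Arity) : Scope → Arity → Type u
  | nil {s : Scope} : Tel ar s .base
  | cons {s : Scope} {α β : Arity} : Kind ar s α → Tel ar (α :: s) β → Tel ar s (.cons α β)
end

/-- Renaming in a base kind. -/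
def BKind.rename {C : Type u} {ar : C → Arity} {s s' : Scope} (ρ : Ren s s') :
    BKind ar s → BKind ar s'
  | .type => .type
  | .El A => .El (A.rename ρ)

mutual
/-- Renaming in a product kind. -/
def Kind.rename {C : Type u} {ar : C → Arity} {s s' : Scope} {α : Arity} (ρ : Ren s s') :
    Kind ar s α → Kind ar s' α
  | .mk Δ T => .mk (Δ.rename ρ) (T.rename (ρ.ext α))
/-- Renaming in a context extension. -/
def Tel.rename {C : Type u} {ar : C → Arity} {s s' : Scope} {α : Arity} (ρ : Ren s s') :
    Tel ar s α → Tel ar s' α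
  | .nil => .nil
  | .cons (α := α) K Δ => .cons (K.rename ρ) (Δ.rename (ρ.lift α))
end

/-- `{F/x}T` for a base kind. -/
def BKind.inst {C : Type u} {ar : C → Arity} {α : Arity} {s s' : Scope} (σ : Inst ar α s s') :
    BKind ar s → BKind ar s'
  | .type => .type
  | .El A => .El (A.inst σ)

mutual
/-- `{F/x}K` for a product kind. -/
def Kind.inst {C : Type u} {ar : C → Arity} {α β : Arity} {s s' : Scope} (σ : Inst ar α s s') :
    Kind ar s β → Kind ar s' β
  | .mk Δ T => .mk (Δ.inst σ) (T.inst (σ.ext β))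
/-- `{F/x}Δ` for a context extension. -/
def Tel.inst {C : Type u} {ar : C → Arity} {α β : Arity} {s s' : Scope} (σ : Inst ar α s s') :
    Tel ar s β → Tel ar s' β
  | .nil => .nil
  | .cons (α := γ) K Δ => .cons (K.inst σ) (Δ.inst (σ.lift γ))
end

/-- `{F⃗/Δ}T` for a base kind. -/
def BKind.instSeq {C : Type u} {ar : C → Arity} {α : Arity} {s : Scope} (G : Args ar s α) :
    BKind ar (ext s α) → BKind ar s
  | .type => .type
  | .El A => .El (TF.instSeq α s G A)

/-- Contexts. -/
inductive Ctx {C : Type u} (ar : C → Arity) : Scope → Type u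
  | nil : Ctx ar []
  | snoc {s : Scope} {α : Arity} : Ctx ar s → Kind ar s α → Ctx ar (α :: s)

/-- The order of a context. -/
def Ctx.order {C : Type u} {ar : C → Arity} {s : Scope} (_ : Ctx ar s) : ℕ := Scope.order s

/-- The context `Γ, Δ`. -/
def Ctx.append {C : Type u} {ar : C → Arity} {s : Scope} {α : Arity} (Γ : Ctx ar s) :
    Tel ar s α → Ctx ar (ext s α)
  | .nil => Γ
  | .cons K Δ => (Γ.snoc K).append Δ

/-- `Γ.lookup x` is the kind `K` with `x : K ∈ Γ`. -/
def Ctx.lookup {C : Type u} {ar : C → Arity} {s : Scope} {α : Arity} :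
    Ctx ar s → Var s α → Kind ar s α
  | .snoc (α := β) _ K, .here => K.rename (Ren.wk β)
  | .snoc (α := β) Γ _, .there x => (Γ.lookup x).rename (Ren.wk β)

/-! ### Judgements -/

/-- The bodies of the three primitive judgement forms: `valid`, `M : T` and `M = N : T`. -/
inductive Body {C : Type u} (ar : C → Arity) (s : Scope) : Type u
  | valid : Body ar s
  | typ : Obj ar s → BKind ar s → Body ar s
  | eq : Obj ar s → Obj ar s → BKind ar s → Body ar s

/-- `{F/x}J` for a judgement body. -/
def Body.inst {C : Type u} {ar : C → Arity} {α : Arity} {s s' : Scope} (σ : Inst ar α s s') :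
    Body ar s → Body ar s'
  | .valid => .valid
  | .typ M T => .typ (M.inst σ) (T.inst σ)
  | .eq M N T => .eq (M.inst σ) (N.inst σ) (T.inst σ)

/-- Primitive judgements. -/
structure Judgement {C : Type u} (ar : C → Arity) : Type u where
  {scope : Scope}
  ctx : Ctx ar scope
  body : Body ar scope

/-- The defined judgement `Γ ⊩ T kind` for a base kind, as a set of primitive judgements. -/
def BKind.isKind {C : Type u} {ar : C → Arity} {s : Scope} (Γ : Ctx ar s) :
    BKind ar s → Set (Judgement ar)
  | .type => {⟨Γ, .valid⟩}
  | .El A => {⟨Γ, .typ A .type⟩}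

/-- The defined judgement `Γ ⊩ (Δ)T kind`. -/
def Kind.isKind {C : Type u} {ar : C → Arity} {s : Scope} {α : Arity} (Γ : Ctx ar s) :
    Kind ar s α → Set (Judgement ar)
  | .mk Δ T => T.isKind (Γ.append Δ)

/-- The defined judgement `Γ ⊩ F : (Δ)T`. -/
def absTyp {C : Type u} {ar : C → Arity} {s : Scope} {α : Arity} (Γ : Ctx ar s) (F : Abs ar s α) :
    Kind ar s α → Set (Judgement ar)
  | .mk Δ T => {⟨Γ.append Δ, .typ F T⟩}

/-- The defined judgement `Γ ⊩ F = G : (Δ)T`. -/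
def absEq {C : Type u} {ar : C → Arity} {s : Scope} {α : Arity} (Γ : Ctx ar s) (F G : Abs ar s α) :
    Kind ar s α → Set (Judgement ar)
  | .mk Δ T => {⟨Γ.append Δ, .eq F G T⟩}

/-- The defined judgement `Γ ⊩ F⃗ :: Δ`: `Γ` is valid, and each `Fᵢ` has the kind
`{F₁, …, Fᵢ₋₁/x₁, …, xᵢ₋₁}Kᵢ`. -/
def seqTyp {C : Type u} {ar : C → Arity} {s : Scope} (Γ : Ctx ar s) :
    {α : Arity} → Args ar s α → Tel ar s α → Set (Judgement ar)
  | .base, .nil, .nil => {⟨Γ, .valid⟩}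
  | .cons _ _, .cons F Fs, .cons K Δ => absTyp Γ F K ∪ seqTyp Γ Fs (Δ.inst (Inst.single F))

/-- The defined judgement `Γ ⊩ F⃗ = G⃗ :: Δ`: `Γ` is valid, and `Fᵢ` and `Gᵢ` are equal abstractions
of the kind `{F₁, …, Fᵢ₋₁/x₁, …, xᵢ₋₁}Kᵢ`. -/
def seqEq {C : Type u} {ar : C → Arity} {s : Scope} (Γ : Ctx ar s) :
    {α : Arity} → Args ar s α → Args ar s α → Tel ar s α → Set (Judgement ar)
  | .base, .nil, .nil, .nil => {⟨Γ, .valid⟩}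
  | .cons _ _, .cons F Fs, .cons G Gs, .cons K Δ =>
      absEq Γ F G K ∪ seqEq Γ Fs Gs (Δ.inst (Inst.single F))

/-! ### Type theory specifications and derivations -/

/-- Declarations: constant declarations `c : K` and equation declarations `(Δ)(M = N : T)`. -/
inductive Decl {C : Type u} (ar : C → Arity) : Type u
  | const (c : C) (K : Kind ar [] (ar c)) : Decl ar
  | eqn {α : Arity} (Δ : Tel ar [] α) (M N : Obj ar (ext [] α)) (T : BKind ar (ext [] α)) : Decl ar

/-- The order of a declaration: the order of `K`, respectively of `Δ`. -/
def Decl.order {C : Type u} {ar : C → Arity} : Decl ar → ℕ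
  | .const c _ => (ar c).order
  | .eqn (α := α) _ _ _ _ => α.order

/-- A type theory specification is a set of declarations. -/
abbrev Spec {C : Type u} (ar : C → Arity) : Type u := Set (Decl ar)

/-- The judgements that are derivable in TF under the specification `𝒯`. A premise that is a defined
judgement stands for all the primitive judgements in it. -/
inductive Derivable {C : Type u} {ar : C → Arity} (𝒯 : Spec ar) :
    {s : Scope} → Ctx ar s → Body ar s → Prop
  | emp_ctxt : Derivable 𝒯 .nil .valid
  | ctxt {s : Scope} {α : Arity} {Γ : Ctx ar s} {K : Kind ar s α} :
      (∀ j ∈ K.isKind Γ, Derivable 𝒯 j.ctx j.body) →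
      Derivable 𝒯 (Γ.snoc K) .valid
  | var {s : Scope} {α : Arity} {Γ : Ctx ar s} {x : Var s α} {Δ : Tel ar s α}
      {T : BKind ar (ext s α)} {F : Args ar s α} :
      Γ.lookup x = .mk Δ T →
      (∀ j ∈ seqTyp Γ F Δ, Derivable 𝒯 j.ctx j.body) →
      Derivable 𝒯 Γ (.typ (.var x F) (T.instSeq F))
  | var_eq {s : Scope} {α : Arity} {Γ : Ctx ar s} {x : Var s α} {Δ : Tel ar s α}
      {T : BKind ar (ext s α)} {F G : Args ar s α} :
      Γ.lookup x = .mk Δ T →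
      (∀ j ∈ seqEq Γ F G Δ, Derivable 𝒯 j.ctx j.body) →
      Derivable 𝒯 Γ (.eq (.var x F) (.var x G) (T.instSeq F))
  | ref {s : Scope} {Γ : Ctx ar s} {M : Obj ar s} {T : BKind ar s} :
      Derivable 𝒯 Γ (.typ M T) → Derivable 𝒯 Γ (.eq M M T)
  | sym {s : Scope} {Γ : Ctx ar s} {M N : Obj ar s} {T : BKind ar s} :
      Derivable 𝒯 Γ (.eq M N T) → Derivable 𝒯 Γ (.eq N M T)
  | trans {s : Scope} {Γ : Ctx ar s} {M N P : Obj ar s} {T : BKind ar s} :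
      Derivable 𝒯 Γ (.eq M N T) → Derivable 𝒯 Γ (.eq N P T) → Derivable 𝒯 Γ (.eq M P T)
  | conv {s : Scope} {Γ : Ctx ar s} {M A B : Obj ar s} :
      Derivable 𝒯 Γ (.typ M (.El A)) → Derivable 𝒯 Γ (.eq A B .type) →
      Derivable 𝒯 Γ (.typ M (.El B))
  | conv_eq {s : Scope} {Γ : Ctx ar s} {M N A B : Obj ar s} :
      Derivable 𝒯 Γ (.eq M N (.El A)) → Derivable 𝒯 Γ (.eq A B .type) →
      Derivable 𝒯 Γ (.eq M N (.El B))
  | const {s : Scope} {Γ : Ctx ar s} {c : C} {Δ : Tel ar [] (ar c)}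
      {T : BKind ar (ext [] (ar c))} {F : Args ar s (ar c)} :
      Decl.const c (.mk Δ T) ∈ 𝒯 →
      (∀ j ∈ seqTyp Γ F (Δ.rename (Ren.closed s)), Derivable 𝒯 j.ctx j.body) →
      Derivable 𝒯 Γ
        (.typ (.const c F) ((T.rename ((Ren.closed s).ext (ar c))).instSeq F))
  | const_eq {s : Scope} {Γ : Ctx ar s} {c : C} {Δ : Tel ar [] (ar c)}
      {T : BKind ar (ext [] (ar c))} {F G : Args ar s (ar c)} :
      Decl.const c (.mk Δ T) ∈ 𝒯 →
      (∀ j ∈ seqEq Γ F G (Δ.rename (Ren.closed s)), Derivable 𝒯 j.ctx j.body) →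
      Derivable 𝒯 Γ
        (.eq (.const c F) (.const c G) ((T.rename ((Ren.closed s).ext (ar c))).instSeq F))
  | eq {s : Scope} {Γ : Ctx ar s} {α : Arity} {Δ : Tel ar [] α} {M N : Obj ar (ext [] α)}
      {T : BKind ar (ext [] α)} {F : Args ar s α} :
      Decl.eqn Δ M N T ∈ 𝒯 →
      (∀ j ∈ seqTyp Γ F (Δ.rename (Ren.closed s)), Derivable 𝒯 j.ctx j.body) →
      Derivable 𝒯 Γ
        (.eq (instSeq α s F (M.rename ((Ren.closed s).ext α)))
          (instSeq α s F (N.rename ((Ren.closed s).ext α)))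
          ((T.rename ((Ren.closed s).ext α)).instSeq F))

/-- A defined judgement is derivable iff all the primitive judgements in it are. -/
def Derives {C : Type u} {ar : C → Arity} (𝒯 : Spec ar) (S : Set (Judgement ar)) : Prop :=
  ∀ j ∈ S, Derivable 𝒯 j.ctx j.body

/-- `Γ ⊩ T = U` for base kinds; it does not hold where it is undefined. -/
def BKindEq {C : Type u} {ar : C → Arity} (𝒯 : Spec ar) {s : Scope} (Γ : Ctx ar s) :
    BKind ar s → BKind ar s → Prop
  | .type, .type => Derivable 𝒯 Γ .valid
  | .El A, .El B => Derivable 𝒯 Γ (.eq A B .type)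
  | .type, .El _ => False
  | .El _, .type => False

mutual
/-- `Γ ⊩ (Δ)T = (Θ)U`, that is, `Γ ⊩ Δ = Θ` and `Γ, Δ ⊩ T = U`. -/
def KindEq {C : Type u} {ar : C → Arity} (𝒯 : Spec ar) {s : Scope} (Γ : Ctx ar s) {α : Arity} :
    Kind ar s α → Kind ar s α → Prop
  | .mk Δ T, .mk Θ U =>
      (Derivable 𝒯 Γ .valid ∧ TelEq 𝒯 Γ Δ Θ) ∧ BKindEq 𝒯 (Γ.append Δ) T U
/-- The part of `Γ ⊩ Δ = Θ` that concerns the entries: `Γ, Δ₀ ⊩ K = L` for all corresponding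
entries `x : K` and `x : L` of `Δ` and `Θ`, where `Δ₀` is the part of `Δ` before `x`. -/
def TelEq {C : Type u} {ar : C → Arity} (𝒯 : Spec ar) {s : Scope} (Γ : Ctx ar s) {α : Arity} :
    Tel ar s α → Tel ar s α → Prop
  | .nil, .nil => True
  | .cons K Δ, .cons L Θ => KindEq 𝒯 Γ K L ∧ TelEq 𝒯 (Γ.snoc K) Δ Θ
end

/-- A specification is `n`-good iff `Γ ⊢ M = N : T` implies `Γ ⊢ M : T` and `Γ ⊢ N : T` for every
context `Γ` of order at most `n`. -/
def Good {C : Type u} {ar : C → Arity} (𝒯 : Spec ar) (n : ℕ) : Prop :=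
  ∀ (s : Scope) (Γ : Ctx ar s) (M N : Obj ar s) (T : BKind ar s), Γ.order ≤ n →
    Derivable 𝒯 Γ (.eq M N T) → Derivable 𝒯 Γ (.typ M T) ∧ Derivable 𝒯 Γ (.typ N T)

end TF

/-!
Cut, functionality and context conversion for the lambda-free framework TF.

The syntactic core is that instantiation commutes with renaming and with itself (`Obj.inst_comm`,
`instInstSeq`). As in other calculi of hereditary substitution, instantiating a `β`-ary variable after
an `α`-ary one may trigger further instantiations, whose arities are members of `α` or of `β`; so the
recursion is on the pair of arities.

Cut and functionality are proved together. For a pair of instantiations `σ`, `τ` that send each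
variable to the same variable or to equal abstractions (`InstCtx`), `M : T` yields
`{σ}M = {τ}M : {σ}T`, and `M = N : T` yields `{σ}M = {σ}N : {σ}T`. Since the specification is good, a
reflexive equation `{σ}M = {σ}M` is as good as a typing, so cut is the case `σ = τ`. The proof is an
induction on the arity `α` of the instantiated variable and, for each `α`, on the derivation
(`functional`). The only case in which the head of an object disappears is `x[G⃗]` for the instantiated
`x`. There the abstraction `[t⃗]P` that replaces `x` has to be instantiated by the sequence `{σ}G⃗`,
whose members have arities in `α`, and the statement for these arities is applied to one member of the
sequence at a time (`SeqFunctional.cons`). The bound on the orders of the declarations serves to keep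
every context of a derivation within order `n`: the members of an arity of order at most `n + 1` have
order at most `n`, so the local contexts of the premises do too, and goodness applies to all of them.

Context conversion is a second induction of the same shape (`telConversion_and_seqConversion`). If
`x : (Δ)T` is replaced by `x : (Δ')T'`, then in a derivation of `x F⃗ : {F⃗/Δ}T` the sequence `F⃗`, typed
in `Δ`, has to be typed in `Δ'`; this uses conversion at the smaller arities in `α`. The resulting
kind `{F⃗/Δ'}T'` equals `{F⃗/Δ}T` by functionality.
-/

namespace TF

universe u

variable {C : Type u} {ar : C → Arity}

/-! ### Renamings and their composition -/

/-- Composition of renamings. -/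
def Ren.comp {s t r : Scope} (ρ' : Ren t r) (ρ : Ren s t) : Ren s r := fun _ x => ρ' _ (ρ _ x)

theorem Ren.lift_comp {s t r : Scope} (ρ' : Ren t r) (ρ : Ren s t) (γ : Arity) :
    (ρ'.comp ρ).lift γ = (ρ'.lift γ).comp (ρ.lift γ) := by
  funext β x
  cases x <;> rfl

theorem Ren.ext_comp {s t r : Scope} (ρ' : Ren t r) (ρ : Ren s t) (γ : Arity) :
    (ρ'.comp ρ).ext γ = (ρ'.ext γ).comp (ρ.ext γ) := by
  induction γ generalizing s t r with
  | base => rfl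
  | cons γ δ _ ih =>
    simp only [Ren.ext, Ren.lift_comp]
    exact ih _ _

mutual
theorem Obj.rename_rename : ∀ {s t r : Scope} (ρ' : Ren t r) (ρ : Ren s t) (M : Obj ar s),
    (M.rename ρ).rename ρ' = M.rename (ρ'.comp ρ)
  | _, _, _, ρ', ρ, .var x G => by
    simp only [Obj.rename, Args.rename_rename ρ' ρ G]; rfl
  | _, _, _, ρ', ρ, .const c G => by
    simp only [Obj.rename, Args.rename_rename ρ' ρ G]
theorem Args.rename_rename : ∀ {s t r : Scope} {α : Arity} (ρ' : Ren t r) (ρ : Ren s t)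
    (G : Args ar s α), (G.rename ρ).rename ρ' = G.rename (ρ'.comp ρ)
  | _, _, _, _, _, _, .nil => by simp only [Args.rename]
  | _, _, _, _, ρ', ρ, .cons (α := α) F G => by
    simp only [Args.rename, Args.rename_rename ρ' ρ G, Ren.ext_comp,
      Obj.rename_rename (ρ'.ext α) (ρ.ext α) F]
end

theorem BKind.rename_rename {s t r : Scope} (ρ' : Ren t r) (ρ : Ren s t) (T : BKind ar s) :
    (T.rename ρ).rename ρ' = T.rename (ρ'.comp ρ) := by
  cases T <;> simp only [BKind.rename, Obj.rename_rename]

mutual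
theorem Kind.rename_rename : ∀ {s t r : Scope} {α : Arity} (ρ' : Ren t r) (ρ : Ren s t)
    (K : Kind ar s α), (K.rename ρ).rename ρ' = K.rename (ρ'.comp ρ)
  | _, _, _, _, ρ', ρ, .mk Δ T => by
    simp only [Kind.rename, Tel.rename_rename ρ' ρ Δ, BKind.rename_rename, Ren.ext_comp]
theorem Tel.rename_rename : ∀ {s t r : Scope} {α : Arity} (ρ' : Ren t r) (ρ : Ren s t)
    (Δ : Tel ar s α), (Δ.rename ρ).rename ρ' = Δ.rename (ρ'.comp ρ)
  | _, _, _, _, _, _, .nil => by simp only [Tel.rename]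
  | _, _, _, _, ρ', ρ, .cons (α := α) K Δ => by
    simp only [Tel.rename, Kind.rename_rename ρ' ρ K, Ren.lift_comp,
      Tel.rename_rename (ρ'.lift α) (ρ.lift α) Δ]
end

/-! ### Instantiation after renaming -/

/-- `{F/x}F⃗` for an abstraction sequence. -/
def Args.inst {α β : Arity} {s t : Scope} (σ : Inst ar α s t) (G : Args ar s β) : Args ar t β :=
  G.instWith (instSeq α) σ

theorem Obj.inst_var {α β : Arity} {s t : Scope} (σ : Inst ar α s t) (x : Var s β)
    (G : Args ar s β) : (Obj.var x G).inst σ = (σ β x).app (instSeq α t) (G.inst σ) := by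
  simp only [Obj.inst, Args.inst, Obj.instWith]

theorem Obj.inst_const {α : Arity} {s t : Scope} (σ : Inst ar α s t) (c : C)
    (G : Args ar s (ar c)) : (Obj.const c G).inst σ = .const c (G.inst σ) := by
  simp only [Obj.inst, Args.inst, Obj.instWith]

theorem Args.inst_nil {α : Arity} {s t : Scope} (σ : Inst ar α s t) :
    (Args.nil : Args ar s .base).inst σ = .nil := by
  simp only [Args.inst, Args.instWith]

theorem Args.inst_cons {α β γ : Arity} {s t : Scope} (σ : Inst ar α s t) (F : Abs ar s β)
    (G : Args ar s γ) : (Args.cons F G).inst σ = .cons (Obj.inst (σ.ext β) F) (G.inst σ) := by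
  simp only [Args.inst, Obj.inst, Args.instWith]

theorem instSeq_cons {α β : Arity} {s : Scope} (F : Abs ar s α) (G : Args ar s β)
    (P : Abs ar (α :: s) β) :
    instSeq (.cons α β) s (.cons F G) P =
      (instSeq β (α :: s) (G.rename (Ren.wk α)) P).inst (Inst.single F) := rfl

/-- An instantiation preceded by a renaming. -/
def Inst.precomp {α : Arity} {s t r : Scope} (σ : Inst ar α t r) (ρ : Ren s t) : Inst ar α s r :=
  fun _ x => σ _ (ρ _ x)

theorem Inst.lift_precomp {α : Arity} {s t r : Scope} (σ : Inst ar α t r) (ρ : Ren s t)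
    (γ : Arity) : (σ.precomp ρ).lift γ = (σ.lift γ).precomp (ρ.lift γ) := by
  funext β x
  cases x <;> rfl

theorem Inst.ext_precomp {α : Arity} {s t r : Scope} (σ : Inst ar α t r) (ρ : Ren s t)
    (γ : Arity) : (σ.precomp ρ).ext γ = (σ.ext γ).precomp (ρ.ext γ) := by
  induction γ generalizing s t r with
  | base => rfl
  | cons γ δ _ ih =>
    simp only [Ren.ext, Inst.ext, Inst.lift_precomp]
    exact ih _ _

mutual
theorem Obj.rename_inst : ∀ {s t r : Scope} {α : Arity} (σ : Inst ar α t r) (ρ : Ren s t)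
    (M : Obj ar s), (M.rename ρ).inst σ = M.inst (σ.precomp ρ)
  | _, _, _, _, σ, ρ, .var x G => by
    simp only [Obj.rename, Obj.inst_var, Args.rename_inst σ ρ G]; rfl
  | _, _, _, _, σ, ρ, .const c G => by
    simp only [Obj.rename, Obj.inst_const, Args.rename_inst σ ρ G]
theorem Args.rename_inst : ∀ {s t r : Scope} {α β : Arity} (σ : Inst ar α t r) (ρ : Ren s t)
    (G : Args ar s β), (G.rename ρ).inst σ = G.inst (σ.precomp ρ)
  | _, _, _, _, _, _, _, .nil => by simp only [Args.rename, Args.inst_nil]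
  | _, _, _, _, _, σ, ρ, .cons (α := β) F G => by
    simp only [Args.rename, Args.inst_cons, Args.rename_inst σ ρ G, Inst.ext_precomp,
      Obj.rename_inst (σ.ext β) (ρ.ext β) F]
end

theorem BKind.rename_inst {s t r : Scope} {α : Arity} (σ : Inst ar α t r) (ρ : Ren s t)
    (T : BKind ar s) : (T.rename ρ).inst σ = T.inst (σ.precomp ρ) := by
  cases T <;> simp only [BKind.rename, BKind.inst, Obj.rename_inst]

mutual
theorem Kind.rename_inst : ∀ {s t r : Scope} {α β : Arity} (σ : Inst ar α t r) (ρ : Ren s t)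
    (K : Kind ar s β), (K.rename ρ).inst σ = K.inst (σ.precomp ρ)
  | _, _, _, _, _, σ, ρ, .mk Δ T => by
    simp only [Kind.rename, Kind.inst, Tel.rename_inst σ ρ Δ, BKind.rename_inst, Inst.ext_precomp]
theorem Tel.rename_inst : ∀ {s t r : Scope} {α β : Arity} (σ : Inst ar α t r) (ρ : Ren s t)
    (Δ : Tel ar s β), (Δ.rename ρ).inst σ = Δ.inst (σ.precomp ρ)
  | _, _, _, _, _, _, _, .nil => by simp only [Tel.rename, Tel.inst]
  | _, _, _, _, _, σ, ρ, .cons (α := γ) K Δ => by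
    simp only [Tel.rename, Tel.inst, Kind.rename_inst σ ρ K, Inst.lift_precomp,
      Tel.rename_inst (σ.lift γ) (ρ.lift γ) Δ]
end

/-! ### Renaming after instantiation -/

/-- Renaming in the image of a variable. -/
def Img.rename {α β : Arity} {s t : Scope} (ρ : Ren s t) : Img ar α s β → Img ar α t β
  | .keep y => .keep (ρ _ y)
  | .repl F => .repl (F.rename (ρ.ext α))

theorem Img.wk_eq_rename {α β γ : Arity} {s : Scope} (i : Img ar α s β) :
    i.wk γ = i.rename (Ren.wk γ) := by
  cases i <;> rfl

theorem Img.rename_rename {α β : Arity} {s t r : Scope} (ρ' : Ren t r) (ρ : Ren s t)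
    (i : Img ar α s β) : (i.rename ρ).rename ρ' = i.rename (ρ'.comp ρ) := by
  cases i <;> simp only [Img.rename, Obj.rename_rename, Ren.ext_comp]
  rfl

/-- An instantiation followed by a renaming. -/
def Inst.postcomp {α : Arity} {s t r : Scope} (ρ : Ren t r) (σ : Inst ar α s t) : Inst ar α s r :=
  fun _ x => (σ _ x).rename ρ

theorem Inst.lift_postcomp {α : Arity} {s t r : Scope} (ρ : Ren t r) (σ : Inst ar α s t)
    (γ : Arity) : (σ.postcomp ρ).lift γ = (σ.lift γ).postcomp (ρ.lift γ) := by
  funext β x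
  cases x with
  | here => rfl
  | there x =>
    simp only [Inst.lift, Inst.postcomp, Img.wk_eq_rename, Img.rename_rename]
    rfl

theorem Inst.ext_postcomp {α : Arity} {s t r : Scope} (ρ : Ren t r) (σ : Inst ar α s t)
    (γ : Arity) : (σ.postcomp ρ).ext γ = (σ.ext γ).postcomp (ρ.ext γ) := by
  induction γ generalizing s t r with
  | base => rfl
  | cons γ δ _ ih =>
    simp only [Ren.ext, Inst.ext, Inst.lift_postcomp]
    exact ih _ _

/-- `{G₁/t₁} ⋯ {Gₙ/tₙ} P` commutes with renaming, for arguments of arity `α`. -/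
def RenameInstSeq (ar : C → Arity) (α : Arity) : Prop :=
  ∀ {s t : Scope} (ρ : Ren s t) (G : Args ar s α) (P : Abs ar s α),
    (instSeq α s G P).rename ρ = instSeq α t (G.rename ρ) (Obj.rename (ρ.ext α) P)

mutual
theorem Obj.inst_rename_of {α : Arity} (h : RenameInstSeq ar α) :
    ∀ {s t r : Scope} (ρ : Ren t r) (σ : Inst ar α s t)
    (M : Obj ar s), (M.inst σ).rename ρ = M.inst (σ.postcomp ρ)
  | _, _, _, ρ, σ, .var (α := β) x G => by
    simp only [Obj.inst_var, ← Args.inst_rename_of h ρ σ G]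
    simp only [Inst.postcomp]
    cases σ β x with
    | keep y => simp only [Img.app, Img.rename, Obj.rename]
    | repl F => exact h ρ _ F
  | _, _, _, ρ, σ, .const c G => by
    simp only [Obj.rename, Obj.inst_const, Args.inst_rename_of h ρ σ G]
theorem Args.inst_rename_of {α : Arity} (h : RenameInstSeq ar α) :
    ∀ {s t r : Scope} {β : Arity} (ρ : Ren t r) (σ : Inst ar α s t)
    (G : Args ar s β), (G.inst σ).rename ρ = G.inst (σ.postcomp ρ)
  | _, _, _, _, _, _, .nil => by simp only [Args.rename, Args.inst_nil]
  | _, _, _, _, ρ, σ, .cons (α := β) F G => by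
    simp only [Args.rename, Args.inst_cons, Args.inst_rename_of h ρ σ G, Inst.ext_postcomp,
      Obj.inst_rename_of h (ρ.ext β) (σ.ext β) F]
end

theorem Args.rename_wk_rename_lift {α γ : Arity} {s t : Scope} (ρ : Ren s t) (G : Args ar s α) :
    (G.rename (Ren.wk γ)).rename (ρ.lift γ) = (G.rename ρ).rename (Ren.wk γ) := by
  rw [Args.rename_rename, Args.rename_rename]
  rfl

theorem renameInstSeq (α : Arity) : RenameInstSeq ar α := by
  induction α with
  | base =>
    intro s t ρ G P
    simp only [instSeq]
    rfl
  | cons α β ihα ihβ =>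
    intro s t ρ G P
    cases G with
    | cons F G =>
      refine (congrArg (Obj.rename ρ) (instSeq_cons F G P)).trans ?_
      rw [Obj.inst_rename_of ihα, Args.rename]
      refine Eq.trans ?_ (instSeq_cons _ _ _).symm
      rw [← Args.rename_wk_rename_lift]
      refine Eq.trans ?_ (congrArg (Obj.inst _) (ihβ (ρ.lift α) (G.rename (Ren.wk α)) P))
      rw [Obj.rename_inst]
      congr 1
      funext γ x
      cases x <;> rfl

theorem Obj.inst_rename {α : Arity} {s t r : Scope} (ρ : Ren t r) (σ : Inst ar α s t)
    (M : Obj ar s) : (M.inst σ).rename ρ = M.inst (σ.postcomp ρ) :=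
  Obj.inst_rename_of (renameInstSeq α) ρ σ M

theorem Args.inst_rename {α β : Arity} {s t r : Scope} (ρ : Ren t r) (σ : Inst ar α s t)
    (G : Args ar s β) : (G.inst σ).rename ρ = G.inst (σ.postcomp ρ) :=
  Args.inst_rename_of (renameInstSeq α) ρ σ G

theorem BKind.inst_rename {s t r : Scope} {α : Arity} (ρ : Ren t r) (σ : Inst ar α s t)
    (T : BKind ar s) : (T.inst σ).rename ρ = T.inst (σ.postcomp ρ) := by
  cases T <;> simp only [BKind.rename, BKind.inst, Obj.inst_rename]

mutual
theorem Kind.inst_rename : ∀ {s t r : Scope} {α β : Arity} (ρ : Ren t r) (σ : Inst ar α s t)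
    (K : Kind ar s β), (K.inst σ).rename ρ = K.inst (σ.postcomp ρ)
  | _, _, _, _, _, ρ, σ, .mk Δ T => by
    simp only [Kind.rename, Kind.inst, Tel.inst_rename ρ σ Δ, BKind.inst_rename, Inst.ext_postcomp]
theorem Tel.inst_rename : ∀ {s t r : Scope} {α β : Arity} (ρ : Ren t r) (σ : Inst ar α s t)
    (Δ : Tel ar s β), (Δ.inst σ).rename ρ = Δ.inst (σ.postcomp ρ)
  | _, _, _, _, _, _, _, .nil => by simp only [Tel.rename, Tel.inst]
  | _, _, _, _, _, ρ, σ, .cons (α := γ) K Δ => by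
    simp only [Tel.rename, Tel.inst, Kind.inst_rename ρ σ K, Inst.lift_postcomp,
      Tel.inst_rename (ρ.lift γ) (σ.lift γ) Δ]
end

/-! ### Instantiations that keep every variable -/

/-- The instantiation that renames every variable and replaces none. -/
def Ren.toInst {s t : Scope} (α : Arity) (ρ : Ren s t) : Inst ar α s t := fun _ x => .keep (ρ _ x)

theorem Ren.toInst_lift {s t : Scope} (α γ : Arity) (ρ : Ren s t) :
    (ρ.toInst α : Inst ar α s t).lift γ = (ρ.lift γ).toInst α := by
  funext β x
  cases x <;> rfl

theorem Ren.toInst_ext {s t : Scope} (α γ : Arity) (ρ : Ren s t) :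
    (ρ.toInst α : Inst ar α s t).ext γ = (ρ.ext γ).toInst α := by
  induction γ generalizing s t with
  | base => rfl
  | cons γ δ _ ih =>
    simp only [Ren.ext, Inst.ext, Ren.toInst_lift]
    exact ih _

mutual
theorem Obj.inst_toInst (α : Arity) : ∀ {s t : Scope} (ρ : Ren s t) (M : Obj ar s),
    M.inst (ρ.toInst α) = M.rename ρ
  | _, _, ρ, .var x G => by
    simp only [Obj.inst_var, Obj.rename, Args.inst_toInst α ρ G]; rfl
  | _, _, ρ, .const c G => by
    simp only [Obj.rename, Obj.inst_const, Args.inst_toInst α ρ G]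
theorem Args.inst_toInst (α : Arity) : ∀ {s t : Scope} {β : Arity} (ρ : Ren s t)
    (G : Args ar s β), G.inst (ρ.toInst α) = G.rename ρ
  | _, _, _, _, .nil => by simp only [Args.rename, Args.inst_nil]
  | _, _, _, ρ, .cons (α := β) F G => by
    simp only [Args.rename, Args.inst_cons, Args.inst_toInst α ρ G, Ren.toInst_ext,
      Obj.inst_toInst α (ρ.ext β) F]
end

theorem BKind.inst_toInst (α : Arity) {s t : Scope} (ρ : Ren s t) (T : BKind ar s) :
    T.inst (ρ.toInst α) = T.rename ρ := by
  cases T <;> simp only [BKind.rename, BKind.inst, Obj.inst_toInst]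

mutual
theorem Kind.inst_toInst (α : Arity) : ∀ {s t : Scope} {β : Arity} (ρ : Ren s t)
    (K : Kind ar s β), K.inst (ρ.toInst α) = K.rename ρ
  | _, _, _, ρ, .mk Δ T => by
    simp only [Kind.rename, Kind.inst, Tel.inst_toInst α ρ Δ, BKind.inst_toInst, Ren.toInst_ext]
theorem Tel.inst_toInst (α : Arity) : ∀ {s t : Scope} {β : Arity} (ρ : Ren s t)
    (Δ : Tel ar s β), Δ.inst (ρ.toInst α) = Δ.rename ρ
  | _, _, _, _, .nil => by simp only [Tel.rename, Tel.inst]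
  | _, _, _, ρ, .cons (α := γ) K Δ => by
    simp only [Tel.rename, Tel.inst, Kind.inst_toInst α ρ K, Ren.toInst_lift,
      Tel.inst_toInst α (ρ.lift γ) Δ]
end

theorem Ren.lift_id {s : Scope} (γ : Arity) :
    Ren.lift (s := s) (fun _ x => x) γ = fun _ x => x := by
  funext β x
  cases x <;> rfl

theorem Ren.ext_id {s : Scope} (γ : Arity) :
    Ren.ext (s := s) (fun _ x => x) γ = fun _ x => x := by
  induction γ generalizing s with
  | base => rfl
  | cons γ δ _ ih =>
    simp only [Ren.ext, Ren.lift_id]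
    exact ih

mutual
theorem Obj.rename_id : ∀ {s : Scope} (M : Obj ar s), M.rename (fun _ x => x) = M
  | _, .var x G => by simp only [Obj.rename, Args.rename_id G]
  | _, .const c G => by simp only [Obj.rename, Args.rename_id G]
theorem Args.rename_id : ∀ {s : Scope} {β : Arity} (G : Args ar s β), G.rename (fun _ x => x) = G
  | _, _, .nil => by simp only [Args.rename]
  | _, _, .cons (α := β) F G => by
    simp only [Args.rename, Args.rename_id G, Ren.ext_id, Obj.rename_id F]
end

theorem BKind.rename_id {s : Scope} (T : BKind ar s) : T.rename (fun _ x => x) = T := by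
  cases T <;> simp only [BKind.rename, Obj.rename_id]

mutual
theorem Kind.rename_id : ∀ {s : Scope} {β : Arity} (K : Kind ar s β), K.rename (fun _ x => x) = K
  | _, _, .mk Δ T => by simp only [Kind.rename, Tel.rename_id Δ, Ren.ext_id, BKind.rename_id T]
theorem Tel.rename_id : ∀ {s : Scope} {β : Arity} (Δ : Tel ar s β), Δ.rename (fun _ x => x) = Δ
  | _, _, .nil => by simp only [Tel.rename]
  | _, _, .cons (α := γ) K Δ => by
    simp only [Tel.rename, Kind.rename_id K, Ren.lift_id, Tel.rename_id Δ]
end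

theorem Args.rename_wk_inst_single {α β : Arity} {s : Scope} (F : Abs ar s α) (G : Args ar s β) :
    (G.rename (Ren.wk α)).inst (Inst.single F) = G := by
  rw [Args.rename_inst]
  exact (Args.inst_toInst α (fun _ x => x) G).trans G.rename_id

theorem Kind.rename_wk_inst_single {α β : Arity} {s : Scope} (F : Abs ar s α) (K : Kind ar s β) :
    (K.rename (Ren.wk α)).inst (Inst.single F) = K := by
  rw [Kind.rename_inst]
  exact (Kind.inst_toInst α (fun _ x => x) K).trans K.rename_id

theorem Inst.precomp_lift_wk {α γ : Arity} {s t : Scope} (σ : Inst ar α s t) :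
    (σ.lift γ).precomp (Ren.wk γ) = σ.postcomp (Ren.wk γ) := by
  funext β x
  exact Img.wk_eq_rename _

theorem Args.rename_wk_inst_lift {α β γ : Arity} {s t : Scope} (σ : Inst ar α s t)
    (G : Args ar s β) :
    (G.rename (Ren.wk γ)).inst (σ.lift γ) = (G.inst σ).rename (Ren.wk γ) := by
  rw [Args.rename_inst, Args.inst_rename, Inst.precomp_lift_wk]

theorem Kind.rename_wk_inst_lift {α β γ : Arity} {s t : Scope} (σ : Inst ar α s t)
    (K : Kind ar s β) :
    (K.rename (Ren.wk γ)).inst (σ.lift γ) = (K.inst σ).rename (Ren.wk γ) := by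
  rw [Kind.rename_inst, Kind.inst_rename, Inst.precomp_lift_wk]

theorem Obj.rename_wk_inst_lift_ext {α β γ : Arity} {s t : Scope} (σ : Inst ar α s t)
    (F : Abs ar s β) :
    Obj.inst ((σ.lift γ).ext β) (Obj.rename ((Ren.wk γ).ext β) F) =
      Obj.rename ((Ren.wk γ).ext β) (Obj.inst (σ.ext β) F) := by
  rw [Obj.rename_inst, Obj.inst_rename, ← Inst.ext_precomp, ← Inst.ext_postcomp,
    Inst.precomp_lift_wk]

theorem Kind.rename_closed_inst {α β : Arity} {s t : Scope} (σ : Inst ar α s t)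
    (K : Kind ar [] β) : (K.rename (Ren.closed s)).inst σ = K.rename (Ren.closed t) := by
  rw [Kind.rename_inst, ← Kind.inst_toInst α (Ren.closed t)]
  congr 1
  funext γ x
  cases x

theorem Obj.rename_closed_inst {α β : Arity} {s t : Scope} (σ : Inst ar α s t)
    (M : Abs ar [] β) :
    Obj.inst (σ.ext β) (Obj.rename ((Ren.closed s).ext β) M) =
      Obj.rename ((Ren.closed t).ext β) M := by
  rw [Obj.rename_inst, ← Obj.inst_toInst α, ← Inst.ext_precomp, ← Ren.toInst_ext]
  congr 2
  funext γ x
  cases x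

theorem Kind.rename_closed_rename {β : Arity} {s t : Scope} (ρ : Ren s t)
    (K : Kind ar [] β) : (K.rename (Ren.closed s)).rename ρ = K.rename (Ren.closed t) := by
  rw [Kind.rename_rename]
  congr 1
  funext γ x
  cases x

theorem Obj.rename_closed_rename {β : Arity} {s t : Scope} (ρ : Ren s t) (M : Abs ar [] β) :
    Obj.rename (ρ.ext β) (Obj.rename ((Ren.closed s).ext β) M) =
      Obj.rename ((Ren.closed t).ext β) M := by
  rw [Obj.rename_rename, ← Ren.ext_comp]
  congr 2
  funext γ x
  cases x

/-! ### Commutation of instantiations -/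

/-- The condition on one variable under which instantiating first along `σ` and then along `τ` is
the same as instantiating first along `τ'` and then along `σ'`. Its parameters are `τ`, `σ'`, and its
indices are the images of the variable under `σ` and `τ'`. -/
inductive Img.Commute {α β : Arity} {t t' r : Scope} (τ : Inst ar β t r) (σ' : Inst ar α t' r) :
    {γ : Arity} → Img ar α t γ → Img ar β t' γ → Prop
  | keep {γ : Arity} {y : Var t γ} {y' : Var t' γ} {z : Var r γ} :
      τ γ y = .keep z → σ' γ y' = .keep z → Commute τ σ' (.keep y) (.keep y')
  | left {F : Abs ar t α} {y' : Var t' α} :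
      σ' α y' = .repl (Obj.inst (τ.ext α) F) → Commute τ σ' (.repl F) (.keep y')
  | right {H : Abs ar t' β} {y : Var t β} :
      τ β y = .repl (Obj.inst (σ'.ext β) H) → Commute τ σ' (.keep y) (.repl H)

/-- `Img.Commute` for all variables. -/
def Inst.Commute {α β : Arity} {s t t' r : Scope} (σ : Inst ar α s t) (τ : Inst ar β t r)
    (τ' : Inst ar β s t') (σ' : Inst ar α t' r) : Prop :=
  ∀ (γ : Arity) (x : Var s γ), Img.Commute τ σ' (σ γ x) (τ' γ x)

theorem Inst.Commute.lift {α β : Arity} {s t t' r : Scope} {σ : Inst ar α s t}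
    {τ : Inst ar β t r} {τ' : Inst ar β s t'} {σ' : Inst ar α t' r}
    (h : Inst.Commute σ τ τ' σ') (γ : Arity) :
    Inst.Commute (σ.lift γ) (τ.lift γ) (τ'.lift γ) (σ'.lift γ) := by
  intro δ x
  cases x with
  | here => exact .keep rfl rfl
  | there x =>
    simp only [Inst.lift]
    have hx := h δ x
    generalize σ δ x = i at hx
    generalize τ' δ x = j at hx
    cases hx with
    | @keep _ y y' z h1 h2 =>
      refine .keep (z := .there z) ?_ ?_
      · simp only [Inst.lift, h1]; rfl
      · simp only [Inst.lift, h2]; rfl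
    | left h1 =>
      refine .left ?_
      simp only [Inst.lift, h1, Img.wk]
      rw [Obj.rename_wk_inst_lift_ext]
    | right h1 =>
      refine .right ?_
      simp only [Inst.lift, h1, Img.wk]
      rw [Obj.rename_wk_inst_lift_ext]

theorem Inst.Commute.ext {α β : Arity} {s t t' r : Scope} {σ : Inst ar α s t}
    {τ : Inst ar β t r} {τ' : Inst ar β s t'} {σ' : Inst ar α t' r}
    (h : Inst.Commute σ τ τ' σ') (γ : Arity) :
    Inst.Commute (σ.ext γ) (τ.ext γ) (τ'.ext γ) (σ'.ext γ) := by
  induction γ generalizing s t t' r with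
  | base => exact h
  | cons γ δ _ ih => exact ih (h.lift γ)

/-- Simultaneous instantiation of a sequence of arity `α` commutes with the instantiation of a
`β`-ary variable. -/
def InstInstSeq (ar : C → Arity) (α β : Arity) : Prop :=
  ∀ {s t : Scope} (τ : Inst ar β s t) (G : Args ar s α) (P : Abs ar s α),
    (instSeq α s G P).inst τ = instSeq α t (G.inst τ) (Obj.inst (τ.ext α) P)

mutual
theorem Obj.inst_comm_of {α β : Arity} (h : InstInstSeq ar α β) (h' : InstInstSeq ar β α) :
    ∀ {s t t' r : Scope} {σ : Inst ar α s t} {τ : Inst ar β t r} {τ' : Inst ar β s t'}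
    {σ' : Inst ar α t' r} (_ : Inst.Commute σ τ τ' σ') (M : Obj ar s),
    (M.inst σ).inst τ = (M.inst τ').inst σ'
  | _, _, _, _, σ, τ, τ', σ', hc, .var (α := γ) x G => by
    have ih := Args.inst_comm_of h h' hc G
    rw [Obj.inst_var, Obj.inst_var]
    have hx := hc γ x
    generalize σ γ x = i at hx
    generalize τ' γ x = j at hx
    cases hx with
    | keep h1 h2 => simp only [Img.app, Obj.inst_var, h1, h2, ih]
    | left h1 => simp only [Img.app, Obj.inst_var, h1, h τ, ih]
    | right h1 => simp only [Img.app, Obj.inst_var, h1, h' σ', ih]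
  | _, _, _, _, _, _, _, _, hc, .const c G => by
    simp only [Obj.inst_const, Args.inst_comm_of h h' hc G]
theorem Args.inst_comm_of {α β : Arity} (h : InstInstSeq ar α β) (h' : InstInstSeq ar β α) :
    ∀ {s t t' r : Scope} {γ : Arity} {σ : Inst ar α s t} {τ : Inst ar β t r} {τ' : Inst ar β s t'}
    {σ' : Inst ar α t' r} (_ : Inst.Commute σ τ τ' σ') (G : Args ar s γ),
    (G.inst σ).inst τ = (G.inst τ').inst σ'
  | _, _, _, _, _, _, _, _, _, _, .nil => by simp only [Args.inst_nil]
  | _, _, _, _, _, _, _, _, _, hc, .cons (α := γ) F G => by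
    simp only [Args.inst_cons, Args.inst_comm_of h h' hc G, Obj.inst_comm_of h h' (hc.ext γ) F]
end

theorem Inst.commute_single {α β : Arity} {s t : Scope} (F : Abs ar s α) (τ : Inst ar β s t) :
    Inst.Commute (Inst.single F) τ (τ.lift α) (Inst.single (Obj.inst (τ.ext α) F)) := by
  intro γ x
  cases x with
  | here => exact .left rfl
  | there x =>
    simp only [Inst.single, Inst.lift]
    cases hx : τ γ x with
    | keep z => exact .keep hx rfl
    | repl H =>
      refine .right ?_
      rw [hx]
      congr 1
      rw [Obj.rename_inst, ← Inst.ext_precomp]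
      symm
      refine Eq.trans (congrArg (fun σ => Obj.inst σ H) ?_)
        ((Obj.inst_toInst α (fun _ x => x) H).trans H.rename_id)
      rw [show (Inst.single (Obj.inst (τ.ext α) F)).precomp (Ren.wk α) =
        Ren.toInst α (fun _ x => x) from rfl, Ren.toInst_ext, Ren.ext_id]

/-- The recursion is on both arities: commuting a `β`-ary instantiation past the sequence commutes
it past the members of the sequence, and where it meets its own variable the roles of the two are
exchanged. -/
theorem instInstSeq (α β : Arity) : InstInstSeq ar α β := by
  obtain ⟨N, hN⟩ : ∃ N, N = sizeOf α + sizeOf β := ⟨_, rfl⟩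
  induction N using Nat.strong_induction_on generalizing α β with
  | _ N ih =>
    intro s t τ G P
    cases α with
    | base =>
      cases G
      simp only [instSeq]
      rfl
    | cons α δ =>
      cases G with
      | cons F G =>
        have s1 : sizeOf (Arity.cons α δ) = 1 + sizeOf α + sizeOf δ := by simp
        have h1 : InstInstSeq ar α β := ih _ (by omega) α β rfl
        have h2 : InstInstSeq ar β α := ih (sizeOf β + sizeOf α) (by omega) β α rfl
        have h3 : InstInstSeq ar δ β := ih _ (by omega) δ β rfl
        refine (congrArg (Obj.inst τ) (instSeq_cons F G P)).trans ?_
        rw [Args.inst_cons, Obj.inst_comm_of h1 h2 (Inst.commute_single F τ)]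
        refine (congrArg (Obj.inst _) (h3 (τ.lift α) (G.rename (Ren.wk α)) P)).trans ?_
        rw [Args.rename_wk_inst_lift]
        rfl

theorem Obj.inst_comm {α β : Arity} {s t t' r : Scope} {σ : Inst ar α s t} {τ : Inst ar β t r}
    {τ' : Inst ar β s t'} {σ' : Inst ar α t' r} (h : Inst.Commute σ τ τ' σ') (M : Obj ar s) :
    (M.inst σ).inst τ = (M.inst τ').inst σ' :=
  Obj.inst_comm_of (instInstSeq α β) (instInstSeq β α) h M

theorem BKind.inst_comm {α β : Arity} {s t t' r : Scope} {σ : Inst ar α s t} {τ : Inst ar β t r}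
    {τ' : Inst ar β s t'} {σ' : Inst ar α t' r} (h : Inst.Commute σ τ τ' σ') (T : BKind ar s) :
    (T.inst σ).inst τ = (T.inst τ').inst σ' := by
  cases T <;> simp only [BKind.inst, Obj.inst_comm h]

mutual
theorem Kind.inst_comm : ∀ {α β γ : Arity} {s t t' r : Scope} {σ : Inst ar α s t}
    {τ : Inst ar β t r} {τ' : Inst ar β s t'} {σ' : Inst ar α t' r} (_ : Inst.Commute σ τ τ' σ')
    (K : Kind ar s γ), (K.inst σ).inst τ = (K.inst τ').inst σ'
  | _, _, γ, _, _, _, _, _, _, _, _, h, .mk Δ T => by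
    simp only [Kind.inst, Tel.inst_comm h Δ, BKind.inst_comm (h.ext γ) T]
theorem Tel.inst_comm : ∀ {α β γ : Arity} {s t t' r : Scope} {σ : Inst ar α s t}
    {τ : Inst ar β t r} {τ' : Inst ar β s t'} {σ' : Inst ar α t' r} (_ : Inst.Commute σ τ τ' σ')
    (Δ : Tel ar s γ), (Δ.inst σ).inst τ = (Δ.inst τ').inst σ'
  | _, _, _, _, _, _, _, _, _, _, _, _, .nil => by simp only [Tel.inst]
  | _, _, _, _, _, _, _, _, _, _, _, h, .cons (α := γ) K Δ => by
    simp only [Tel.inst, Kind.inst_comm h K, Tel.inst_comm (h.lift γ) Δ]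
end

theorem Tel.inst_single_inst {α β γ : Arity} {s t : Scope} (F : Abs ar s α) (τ : Inst ar β s t)
    (Δ : Tel ar (α :: s) γ) :
    (Δ.inst (Inst.single F)).inst τ =
      (Δ.inst (τ.lift α)).inst (Inst.single (Obj.inst (τ.ext α) F)) :=
  Tel.inst_comm (Inst.commute_single F τ) Δ

theorem Tel.inst_single_rename {α γ : Arity} {s t : Scope} (F : Abs ar s α) (ρ : Ren s t)
    (Δ : Tel ar (α :: s) γ) :
    (Δ.inst (Inst.single F)).rename ρ =
      (Δ.rename (ρ.lift α)).inst (Inst.single (Obj.rename (ρ.ext α) F)) := by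
  rw [Tel.inst_rename, Tel.rename_inst]
  congr 1
  funext β x
  cases x <;> rfl

theorem BKind.instSeq_inst {α β : Arity} {s t : Scope} (τ : Inst ar β s t) (G : Args ar s α)
    (T : BKind ar (TF.ext s α)) :
    (T.instSeq G).inst τ = (T.inst (τ.ext α)).instSeq (G.inst τ) := by
  cases T with
  | type => rfl
  | El A => exact congrArg BKind.El (instInstSeq α β τ G A)

theorem BKind.instSeq_rename {α : Arity} {s t : Scope} (ρ : Ren s t) (G : Args ar s α)
    (T : BKind ar (TF.ext s α)) :
    (T.instSeq G).rename ρ = (T.rename (ρ.ext α)).instSeq (G.rename ρ) := by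
  cases T with
  | type => rfl
  | El A => exact congrArg BKind.El (renameInstSeq α ρ G A)

theorem instSeq_cons_eq {α β : Arity} {s : Scope} (F : Abs ar s α) (G : Args ar s β)
    (P : Abs ar (α :: s) β) :
    instSeq (.cons α β) s (.cons F G) P =
      instSeq β s G (Obj.inst ((Inst.single F).ext β) P) := by
  rw [instSeq_cons, instInstSeq, Args.rename_wk_inst_single]

theorem BKind.instSeq_cons_eq {α β : Arity} {s : Scope} (F : Abs ar s α) (G : Args ar s β)
    (T : BKind ar (TF.ext (α :: s) β)) :
    BKind.instSeq (Args.cons F G) T = (T.inst ((Inst.single F).ext β)).instSeq G := by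
  cases T with
  | type => rfl
  | El A => exact congrArg BKind.El (TF.instSeq_cons_eq F G A)

/-! ### Orders of scopes and arities -/

theorem order_ext (s : Scope) (γ : Arity) :
    Scope.order (TF.ext s γ) = max (Scope.order s) γ.order := by
  induction γ generalizing s with
  | base => simp [TF.ext, Arity.order]
  | cons γ δ _ ih => simp only [TF.ext, Arity.order, ih, Scope.order]; omega

theorem Var.order_lt {s : Scope} {β : Arity} (x : Var s β) : β.order < Scope.order s := by
  induction x with
  | here => simp only [Scope.order]; omega
  | there x ih => simp only [Scope.order]; omega

/-! ### Members of the defined judgements -/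

section Members

variable {s : Scope} {α β : Arity} {Γ : Ctx ar s} {p : Judgement ar → Prop}

theorem forall_absTyp {F : Abs ar s α} {Δ : Tel ar s α} {T : BKind ar (TF.ext s α)} :
    (∀ j ∈ absTyp Γ F (.mk Δ T), p j) ↔ p ⟨Γ.append Δ, .typ F T⟩ := by
  simp [absTyp]

theorem forall_absEq {F G : Abs ar s α} {Δ : Tel ar s α} {T : BKind ar (TF.ext s α)} :
    (∀ j ∈ absEq Γ F G (.mk Δ T), p j) ↔ p ⟨Γ.append Δ, .eq F G T⟩ := by
  simp [absEq]

theorem forall_seqTyp_nil : (∀ j ∈ seqTyp Γ .nil .nil, p j) ↔ p ⟨Γ, .valid⟩ := by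
  simp [seqTyp]

theorem forall_seqTyp_cons {F : Abs ar s α} {Fs : Args ar s β} {K : Kind ar s α}
    {Δ : Tel ar (α :: s) β} :
    (∀ j ∈ seqTyp Γ (.cons F Fs) (.cons K Δ), p j) ↔
      (∀ j ∈ absTyp Γ F K, p j) ∧ ∀ j ∈ seqTyp Γ Fs (Δ.inst (Inst.single F)), p j := by
  simp only [seqTyp, Set.mem_union, or_imp, forall_and]

theorem forall_seqEq_nil : (∀ j ∈ seqEq Γ .nil .nil .nil, p j) ↔ p ⟨Γ, .valid⟩ := by
  simp [seqEq]

theorem forall_seqEq_cons {F G : Abs ar s α} {Fs Gs : Args ar s β} {K : Kind ar s α}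
    {Δ : Tel ar (α :: s) β} :
    (∀ j ∈ seqEq Γ (.cons F Fs) (.cons G Gs) (.cons K Δ), p j) ↔
      (∀ j ∈ absEq Γ F G K, p j) ∧ ∀ j ∈ seqEq Γ Fs Gs (Δ.inst (Inst.single F)), p j := by
  simp only [seqEq, Set.mem_union, or_imp, forall_and]

theorem forall_isKind_type {Δ : Tel ar s α} :
    (∀ j ∈ Kind.isKind Γ (.mk Δ .type), p j) ↔ p ⟨Γ.append Δ, .valid⟩ := by
  simp [Kind.isKind, BKind.isKind]

theorem forall_isKind_El {Δ : Tel ar s α} {A : Obj ar (TF.ext s α)} :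
    (∀ j ∈ Kind.isKind Γ (.mk Δ (.El A)), p j) ↔ p ⟨Γ.append Δ, .typ A .type⟩ := by
  simp [Kind.isKind, BKind.isKind]

theorem valid_mem_seqTyp {F : Args ar s α} {Δ : Tel ar s α} :
    (⟨Γ, .valid⟩ : Judgement ar) ∈ seqTyp Γ F Δ := by
  induction α with
  | base => cases F; cases Δ; simp [seqTyp]
  | cons α β _ ih => cases F; cases Δ; exact Or.inr ih

theorem valid_mem_seqEq {F G : Args ar s α} {Δ : Tel ar s α} :
    (⟨Γ, .valid⟩ : Judgement ar) ∈ seqEq Γ F G Δ := by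
  induction α with
  | base => cases F; cases G; cases Δ; simp [seqEq]
  | cons α β _ ih => cases F; cases G; cases Δ; exact Or.inr ih

end Members

/-! ### Validity of contexts -/

variable {𝒯 : Spec ar}

theorem Derivable.valid {s : Scope} {Γ : Ctx ar s} {J : Body ar s} (h : Derivable 𝒯 Γ J) :
    Derivable 𝒯 Γ .valid := by
  induction h with
  | emp_ctxt => exact .emp_ctxt
  | ctxt h _ => exact .ctxt h
  | var _ _ ih => exact ih _ valid_mem_seqTyp
  | var_eq _ _ ih => exact ih _ valid_mem_seqEq
  | ref _ ih => exact ih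
  | sym _ ih => exact ih
  | trans _ _ ih _ => exact ih
  | conv _ _ ih _ => exact ih
  | conv_eq _ _ ih _ => exact ih
  | const _ _ ih => exact ih _ valid_mem_seqTyp
  | const_eq _ _ ih => exact ih _ valid_mem_seqEq
  | eq _ _ ih => exact ih _ valid_mem_seqTyp

theorem Derivable.isKind_of_snoc {s : Scope} {α : Arity} {Γ : Ctx ar s} {K : Kind ar s α}
    (h : Derivable 𝒯 (Γ.snoc K) .valid) : Derives 𝒯 (K.isKind Γ) := by
  cases h with
  | ctxt h => exact h

mutual
theorem Kind.valid_of_isKind : ∀ {s : Scope} {α : Arity} {Γ : Ctx ar s} (K : Kind ar s α),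
    Derives 𝒯 (K.isKind Γ) → Derivable 𝒯 Γ .valid
  | _, _, _, .mk Δ .type, h => Tel.valid_of_append Δ (forall_isKind_type.1 h)
  | _, _, _, .mk Δ (.El _), h => Tel.valid_of_append Δ (forall_isKind_El.1 h).valid
theorem Tel.valid_of_append : ∀ {s : Scope} {α : Arity} {Γ : Ctx ar s} (Δ : Tel ar s α),
    Derivable 𝒯 (Γ.append Δ) .valid → Derivable 𝒯 Γ .valid
  | _, _, _, .nil, h => h
  | _, _, _, .cons K Δ, h => Kind.valid_of_isKind K (Tel.valid_of_append Δ h).isKind_of_snoc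
end

theorem Derivable.valid_of_snoc {s : Scope} {α : Arity} {Γ : Ctx ar s} {K : Kind ar s α}
    (h : Derivable 𝒯 (Γ.snoc K) .valid) : Derivable 𝒯 Γ .valid :=
  K.valid_of_isKind h.isKind_of_snoc

/-! ### Renaming and weakening of derivations -/

/-- Renaming in a judgement body. -/
def Body.rename {s t : Scope} (ρ : Ren s t) : Body ar s → Body ar t
  | .valid => .valid
  | .typ M T => .typ (M.rename ρ) (T.rename ρ)
  | .eq M N T => .eq (M.rename ρ) (N.rename ρ) (T.rename ρ)

/-- `ρ` maps the variables of `Γ` to variables of `Γ'` of the (renamed) same kinds. -/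
def RenLookup {s t : Scope} (Γ : Ctx ar s) (Γ' : Ctx ar t) (ρ : Ren s t) : Prop :=
  ∀ (β : Arity) (x : Var s β), Γ'.lookup (ρ β x) = (Γ.lookup x).rename ρ

/-- The renamings along which derivations are transported: kind-preserving maps into a valid
context, under entries that are declared on both sides. The entries are kept apart since the
validity of the extended target context is a result of the transport. -/
inductive RenCtx (𝒯 : Spec ar) : {s t : Scope} → Ctx ar s → Ctx ar t → Ren s t → Prop
  | base {s t : Scope} {Γ : Ctx ar s} {Γ' : Ctx ar t} {ρ : Ren s t} :
      Derivable 𝒯 Γ' .valid → RenLookup Γ Γ' ρ → RenCtx 𝒯 Γ Γ' ρ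
  | snoc {s t : Scope} {Γ : Ctx ar s} {Γ' : Ctx ar t} {ρ : Ren s t} {α : Arity}
      (K : Kind ar s α) : RenCtx 𝒯 Γ Γ' ρ →
      RenCtx 𝒯 (Γ.snoc K) (Γ'.snoc (K.rename ρ)) (ρ.lift α)

theorem RenLookup.wk {s : Scope} {α : Arity} (Γ : Ctx ar s) (K : Kind ar s α) :
    RenLookup Γ (Γ.snoc K) (Ren.wk α) := fun _ _ => rfl

theorem RenCtx.lookup {s t : Scope} {Γ : Ctx ar s} {Γ' : Ctx ar t} {ρ : Ren s t}
    (h : RenCtx 𝒯 Γ Γ' ρ) : RenLookup Γ Γ' ρ := by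
  induction h with
  | base _ h => exact h
  | snoc K _ ih =>
    intro β x
    cases x with
    | here =>
      simp only [Ren.lift, Ctx.lookup, Kind.rename_rename]
      rfl
    | there x =>
      simp only [Ren.lift, Ctx.lookup, Kind.rename_rename, ih β x]
      rfl

theorem RenCtx.append {s t : Scope} {Γ : Ctx ar s} {Γ' : Ctx ar t} {ρ : Ren s t} {α : Arity}
    (h : RenCtx 𝒯 Γ Γ' ρ) (Δ : Tel ar s α) :
    RenCtx 𝒯 (Γ.append Δ) (Γ'.append (Δ.rename ρ)) (ρ.ext α) := by
  induction α generalizing s t with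
  | base =>
    cases Δ
    simp only [Tel.rename, Ctx.append, Ren.ext]
    exact h
  | cons α β _ ih =>
    cases Δ with
    | cons K Δ =>
      simp only [Tel.rename, Ctx.append, Ren.ext]
      exact ih (h.snoc K) Δ

/-- The judgement can be transported along all renamings of its context. -/
def Renamable (𝒯 : Spec ar) (j : Judgement ar) : Prop :=
  ∀ {t : Scope} (Γ' : Ctx ar t) (ρ : Ren j.scope t), RenCtx 𝒯 j.ctx Γ' ρ →
    Derivable 𝒯 Γ' (j.body.rename ρ)

section Renaming

variable {s t : Scope} {α : Arity} {Γ : Ctx ar s} {Γ' : Ctx ar t} {ρ : Ren s t}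

theorem absTyp_rename {F : Abs ar s α} {K : Kind ar s α}
    (h : ∀ j ∈ absTyp Γ F K, Renamable 𝒯 j) (hρ : RenCtx 𝒯 Γ Γ' ρ) :
    Derives 𝒯 (absTyp Γ' (Obj.rename (ρ.ext α) F) (K.rename ρ)) := by
  cases K with
  | mk Δ T =>
    simp only [Kind.rename, Derives, forall_absTyp]
    exact forall_absTyp.1 h _ _ (hρ.append Δ)

theorem absEq_rename {F G : Abs ar s α} {K : Kind ar s α}
    (h : ∀ j ∈ absEq Γ F G K, Renamable 𝒯 j) (hρ : RenCtx 𝒯 Γ Γ' ρ) :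
    Derives 𝒯 (absEq Γ' (Obj.rename (ρ.ext α) F) (Obj.rename (ρ.ext α) G) (K.rename ρ)) := by
  cases K with
  | mk Δ T =>
    simp only [Kind.rename, Derives, forall_absEq]
    exact forall_absEq.1 h _ _ (hρ.append Δ)

theorem isKind_rename {K : Kind ar s α}
    (h : ∀ j ∈ K.isKind Γ, Renamable 𝒯 j) (hρ : RenCtx 𝒯 Γ Γ' ρ) :
    Derives 𝒯 ((K.rename ρ).isKind Γ') := by
  cases K with
  | mk Δ T =>
    cases T with
    | type =>
      simp only [Kind.rename, BKind.rename, Derives, forall_isKind_type]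
      exact forall_isKind_type.1 h _ _ (hρ.append Δ)
    | El A =>
      simp only [Kind.rename, BKind.rename, Derives, forall_isKind_El]
      exact forall_isKind_El.1 h _ _ (hρ.append Δ)

theorem seqTyp_rename {F : Args ar s α} {Δ : Tel ar s α}
    (h : ∀ j ∈ seqTyp Γ F Δ, Renamable 𝒯 j) (hρ : RenCtx 𝒯 Γ Γ' ρ) :
    Derives 𝒯 (seqTyp Γ' (F.rename ρ) (Δ.rename ρ)) := by
  induction α with
  | base =>
    cases F; cases Δ
    simp only [Args.rename, Tel.rename, Derives, forall_seqTyp_nil]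
    exact forall_seqTyp_nil.1 h _ _ hρ
  | cons α β _ ih =>
    cases F; cases Δ
    obtain ⟨h1, h2⟩ := forall_seqTyp_cons.1 h
    simp only [Args.rename, Tel.rename, Derives, forall_seqTyp_cons]
    refine ⟨absTyp_rename h1 hρ, ?_⟩
    rw [← Tel.inst_single_rename]
    exact ih h2

theorem seqEq_rename {F G : Args ar s α} {Δ : Tel ar s α}
    (h : ∀ j ∈ seqEq Γ F G Δ, Renamable 𝒯 j) (hρ : RenCtx 𝒯 Γ Γ' ρ) :
    Derives 𝒯 (seqEq Γ' (F.rename ρ) (G.rename ρ) (Δ.rename ρ)) := by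
  induction α with
  | base =>
    cases F; cases G; cases Δ
    simp only [Args.rename, Tel.rename, Derives, forall_seqEq_nil]
    exact forall_seqEq_nil.1 h _ _ hρ
  | cons α β _ ih =>
    cases F; cases G; cases Δ
    obtain ⟨h1, h2⟩ := forall_seqEq_cons.1 h
    simp only [Args.rename, Tel.rename, Derives, forall_seqEq_cons]
    refine ⟨absEq_rename h1 hρ, ?_⟩
    rw [← Tel.inst_single_rename]
    exact ih h2

end Renaming

/-- Weakening is the case of `Ren.wk`, into any valid extension of the context. -/
theorem Derivable.rename {s : Scope} {Γ : Ctx ar s} {J : Body ar s} (h : Derivable 𝒯 Γ J) :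
    Renamable 𝒯 ⟨Γ, J⟩ := by
  have hclosed {α : Arity} {s t : Scope} (ρ : Ren s t) (Δ : Tel ar [] α)
      (T : BKind ar (TF.ext [] α)) :
      (Δ.rename (Ren.closed s)).rename ρ = Δ.rename (Ren.closed t) ∧
      (T.rename ((Ren.closed s).ext α)).rename (ρ.ext α) = T.rename ((Ren.closed t).ext α) := by
    have h := Kind.rename_closed_rename ρ (.mk Δ T)
    simpa only [Kind.rename, Kind.mk.injEq] using h
  induction h with
  | emp_ctxt =>
    intro t Γ' ρ hρ
    cases hρ with
    | base h _ => exact h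
  | ctxt _ ih =>
    intro t Γ' ρ hρ
    cases hρ with
    | base h _ => exact h
    | snoc K hρ => exact .ctxt (isKind_rename ih hρ)
  | @var s α Γ x Δ T F hx _ ih =>
    intro t Γ' ρ hρ
    have hl := hρ.lookup α x
    simp only [hx, Kind.rename] at hl
    simp only [Body.rename, BKind.instSeq_rename, Obj.rename]
    exact .var hl (seqTyp_rename ih hρ)
  | @var_eq s α Γ x Δ T F G hx _ ih =>
    intro t Γ' ρ hρ
    have hl := hρ.lookup α x
    simp only [hx, Kind.rename] at hl
    simp only [Body.rename, BKind.instSeq_rename, Obj.rename]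
    exact .var_eq hl (seqEq_rename ih hρ)
  | ref _ ih => intro t Γ' ρ hρ; exact .ref (ih _ _ hρ)
  | sym _ ih => intro t Γ' ρ hρ; exact .sym (ih _ _ hρ)
  | trans _ _ ih ih' => intro t Γ' ρ hρ; exact .trans (ih _ _ hρ) (ih' _ _ hρ)
  | conv _ _ ih ih' => intro t Γ' ρ hρ; exact .conv (ih _ _ hρ) (ih' _ _ hρ)
  | conv_eq _ _ ih ih' => intro t Γ' ρ hρ; exact .conv_eq (ih _ _ hρ) (ih' _ _ hρ)
  | @const s Γ c Δ T F hc _ ih =>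
    intro t Γ' ρ hρ
    have h := seqTyp_rename ih hρ
    obtain ⟨h1, h2⟩ := hclosed ρ Δ T
    simp only [Body.rename, BKind.instSeq_rename, Obj.rename, h2]
    rw [h1] at h
    exact .const hc h
  | @const_eq s Γ c Δ T F G hc _ ih =>
    intro t Γ' ρ hρ
    have h := seqEq_rename ih hρ
    obtain ⟨h1, h2⟩ := hclosed ρ Δ T
    simp only [Body.rename, BKind.instSeq_rename, Obj.rename, h2]
    rw [h1] at h
    exact .const_eq hc h
  | @eq s Γ α Δ M N T F hc _ ih =>
    intro t Γ' ρ hρ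
    have h := seqTyp_rename ih hρ
    obtain ⟨h1, h2⟩ := hclosed ρ Δ T
    simp only [Body.rename, BKind.instSeq_rename, renameInstSeq α ρ, h2,
      Obj.rename_closed_rename]
    rw [h1] at h
    exact .eq hc h

/-! ### Pairs of instantiations between contexts -/

/-- The images of one variable under two instantiations are related, in the context `Γ` and at the
kind `K`: both are the same variable of kind `K`, or they are equal abstractions of kind `K`. -/
inductive Img.Related (𝒯 : Spec ar) {α : Arity} {t : Scope} (Γ : Ctx ar t) :
    {β : Arity} → Kind ar t β → Img ar α t β → Img ar α t β → Prop
  | keep {β : Arity} {K : Kind ar t β} {y : Var t β} : Γ.lookup y = K →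
      Related 𝒯 Γ K (.keep y) (.keep y)
  | repl {K : Kind ar t α} {F G : Abs ar t α} : Derives 𝒯 (absEq Γ F G K) →
      Related 𝒯 Γ K (.repl F) (.repl G)

/-- `σ` and `τ` have related images on every variable of `Γ`. -/
def InstRelated (𝒯 : Spec ar) {α : Arity} {s t : Scope} (Γ : Ctx ar s) (Γ' : Ctx ar t)
    (σ τ : Inst ar α s t) : Prop :=
  ∀ (β : Arity) (x : Var s β), Img.Related 𝒯 Γ' ((Γ.lookup x).inst σ) (σ β x) (τ β x)

/-- The pairs of instantiations from `Γ` to `Γ'` along which functionality is proved: related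
instantiations into a valid context, under entries that are declared on both sides and instantiated
along the first member of the pair. A pair `(σ, σ)` expresses that `σ` alone is well-typed. -/
inductive InstCtx (𝒯 : Spec ar) {α : Arity} :
    {s t : Scope} → Ctx ar s → Ctx ar t → Inst ar α s t → Inst ar α s t → Prop
  | base {s t : Scope} {Γ : Ctx ar s} {Γ' : Ctx ar t} {σ τ : Inst ar α s t} :
      Derivable 𝒯 Γ' .valid → InstRelated 𝒯 Γ Γ' σ τ → InstCtx 𝒯 Γ Γ' σ τ
  | snoc {s t : Scope} {Γ : Ctx ar s} {Γ' : Ctx ar t} {σ τ : Inst ar α s t} {γ : Arity}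
      (K : Kind ar s γ) : InstCtx 𝒯 Γ Γ' σ τ →
      InstCtx 𝒯 (Γ.snoc K) (Γ'.snoc (K.inst σ)) (σ.lift γ) (τ.lift γ)

theorem InstCtx.related {α : Arity} {s t : Scope} {Γ : Ctx ar s} {Γ' : Ctx ar t}
    {σ τ : Inst ar α s t} (h : InstCtx 𝒯 Γ Γ' σ τ) (hv : Derivable 𝒯 Γ' .valid) :
    InstRelated 𝒯 Γ Γ' σ τ := by
  induction h with
  | base _ h => exact h
  | @snoc s t Γ Γ' σ τ γ K _ ih =>
    intro β x
    cases x with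
    | here =>
      refine .keep ?_
      simp only [Ctx.lookup, Kind.rename_wk_inst_lift]
    | there x =>
      simp only [Ctx.lookup, Kind.rename_wk_inst_lift, Inst.lift]
      have hx := ih hv.valid_of_snoc β x
      generalize σ β x = i at hx
      generalize τ β x = j at hx
      cases hx with
      | keep hy =>
        refine .keep ?_
        simp only [Ctx.lookup, hy]
      | repl h =>
        exact .repl (absEq_rename (fun j hj => (h j hj).rename) (.base hv (.wk _ _)))

theorem InstCtx.append {α γ : Arity} {s t : Scope} {Γ : Ctx ar s} {Γ' : Ctx ar t}
    {σ τ : Inst ar α s t} (h : InstCtx 𝒯 Γ Γ' σ τ) (Δ : Tel ar s γ) :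
    InstCtx 𝒯 (Γ.append Δ) (Γ'.append (Δ.inst σ)) (σ.ext γ) (τ.ext γ) := by
  induction γ generalizing s t with
  | base =>
    cases Δ
    simp only [Tel.inst, Ctx.append, Inst.ext]
    exact h
  | cons γ δ _ ih =>
    cases Δ with
    | cons K Δ =>
      simp only [Tel.inst, Ctx.append, Inst.ext]
      exact ih (h.snoc K) Δ

/-- `F = G : K` relates the instantiations `{F/x}` and `{G/x}`. -/
theorem InstCtx.single {α : Arity} {s : Scope} {Γ : Ctx ar s} {K : Kind ar s α} {F G : Abs ar s α}
    (hv : Derivable 𝒯 Γ .valid) (h : Derives 𝒯 (absEq Γ F G K)) :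
    InstCtx 𝒯 (Γ.snoc K) Γ (Inst.single F) (Inst.single G) := by
  refine .base hv fun β x => ?_
  cases x with
  | here =>
    refine .repl ?_
    simpa only [Ctx.lookup, Kind.rename_wk_inst_single] using h
  | there x =>
    refine .keep ?_
    simp only [Ctx.lookup, Kind.rename_wk_inst_single]

/-! ### Equality and typing in good specifications -/

theorem Good.left {n : ℕ} (hg : Good 𝒯 n) {s : Scope} {Γ : Ctx ar s} {M N : Obj ar s}
    {T : BKind ar s} (hs : Scope.order s ≤ n) (h : Derivable 𝒯 Γ (.eq M N T)) :
    Derivable 𝒯 Γ (.typ M T) := (hg s Γ M N T hs h).1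

theorem Good.right {n : ℕ} (hg : Good 𝒯 n) {s : Scope} {Γ : Ctx ar s} {M N : Obj ar s}
    {T : BKind ar s} (hs : Scope.order s ≤ n) (h : Derivable 𝒯 Γ (.eq M N T)) :
    Derivable 𝒯 Γ (.typ N T) := (hg s Γ M N T hs h).2

theorem absEq_refl {s : Scope} {α : Arity} {Γ : Ctx ar s} {K : Kind ar s α} {F : Abs ar s α}
    (h : Derives 𝒯 (absTyp Γ F K)) : Derives 𝒯 (absEq Γ F F K) := by
  cases K
  exact forall_absEq.2 (.ref (forall_absTyp.1 h))

theorem Good.absTyp_left {n : ℕ} (hg : Good 𝒯 n) {s : Scope} {α : Arity} {Γ : Ctx ar s}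
    {K : Kind ar s α} {F G : Abs ar s α} (hs : Scope.order s ≤ n) (hα : α.order ≤ n)
    (h : Derives 𝒯 (absEq Γ F G K)) : Derives 𝒯 (absTyp Γ F K) := by
  cases K
  exact forall_absTyp.2 (hg.left (by rw [order_ext]; omega) (forall_absEq.1 h))

theorem seqEq_refl {s : Scope} {α : Arity} {Γ : Ctx ar s} {Δ : Tel ar s α} {F : Args ar s α}
    (h : Derives 𝒯 (seqTyp Γ F Δ)) : Derives 𝒯 (seqEq Γ F F Δ) := by
  induction α with
  | base => cases F; cases Δ; exact forall_seqEq_nil.2 (forall_seqTyp_nil.1 h)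
  | cons α β _ ih =>
    cases F; cases Δ
    obtain ⟨h1, h2⟩ := forall_seqTyp_cons.1 h
    exact forall_seqEq_cons.2 ⟨absEq_refl h1, ih h2⟩

theorem Good.seqTyp_left {n : ℕ} (hg : Good 𝒯 n) {s : Scope} {α : Arity} {Γ : Ctx ar s}
    {Δ : Tel ar s α} {F G : Args ar s α} (hs : Scope.order s ≤ n) (hα : α.order ≤ n + 1)
    (h : Derives 𝒯 (seqEq Γ F G Δ)) : Derives 𝒯 (seqTyp Γ F Δ) := by
  induction α with
  | base => cases F; cases G; cases Δ; exact forall_seqTyp_nil.2 (forall_seqEq_nil.1 h)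
  | cons α β _ ih =>
    cases F; cases G; cases Δ
    simp only [Arity.order] at hα
    obtain ⟨h1, h2⟩ := forall_seqEq_cons.1 h
    exact forall_seqTyp_cons.2 ⟨hg.absTyp_left hs (by omega) h1, ih (by omega) h2⟩

theorem InstCtx.refl_left {n : ℕ} (hg : Good 𝒯 n) {α : Arity} {s t : Scope} {Γ : Ctx ar s}
    {Γ' : Ctx ar t} {σ τ : Inst ar α s t} (h : InstCtx 𝒯 Γ Γ' σ τ) (hs : Scope.order s ≤ n)
    (ht : Scope.order t ≤ n) : InstCtx 𝒯 Γ Γ' σ σ := by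
  induction h with
  | @base s t Γ Γ' σ τ hv h =>
    refine .base hv fun β x => ?_
    have hx := h β x
    have hβ := x.order_lt
    generalize σ β x = i at hx ⊢
    generalize τ β x = j at hx
    cases hx with
    | keep hy => exact .keep hy
    | repl h => exact .repl (absEq_refl (hg.absTyp_left ht (by omega) h))
  | snoc K _ ih =>
    simp only [Scope.order] at hs ht
    exact .snoc K (ih (by omega) (by omega))

/-! ### Functionality -/

/-- The judgement body that functionality derives from a body along a pair of instantiations:
`M : T` becomes `{σ}M = {τ}M : {σ}T`, and in the other bodies only `σ` is used. -/
def Body.inst₂ {α : Arity} {s t : Scope} (σ τ : Inst ar α s t) : Body ar s → Body ar t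
  | .valid => .valid
  | .typ M T => .eq (M.inst σ) (M.inst τ) (T.inst σ)
  | .eq M N T => .eq (M.inst σ) (N.inst σ) (T.inst σ)

/-- Functionality of one judgement along all pairs of instantiations of an `α`-ary variable. -/
def FunctionalJ (𝒯 : Spec ar) (n : ℕ) (α : Arity) (j : Judgement ar) : Prop :=
  ∀ {t : Scope} (Γ' : Ctx ar t) (σ τ : Inst ar α j.scope t), Scope.order j.scope ≤ n →
    Scope.order t ≤ n → InstCtx 𝒯 j.ctx Γ' σ τ → Derivable 𝒯 Γ' (j.body.inst₂ σ τ)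

/-- Functionality for the instantiation of `α`-ary variables. -/
def Functional (𝒯 : Spec ar) (n : ℕ) (α : Arity) : Prop :=
  ∀ {s : Scope} {Γ : Ctx ar s} {J : Body ar s}, Derivable 𝒯 Γ J → FunctionalJ 𝒯 n α ⟨Γ, J⟩

/-- Functionality for the instantiation of `α`-ary sequences of variables, in two equal objects. -/
def SeqFunctional (𝒯 : Spec ar) (n : ℕ) (α : Arity) : Prop :=
  ∀ {s : Scope} {Γ : Ctx ar s} {Θ : Tel ar s α} {P Q : Abs ar s α} {T : BKind ar (TF.ext s α)}
    {G H : Args ar s α}, Scope.order (TF.ext s α) ≤ n → Derivable 𝒯 (Γ.append Θ) (.eq P Q T) →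
    Derives 𝒯 (seqEq Γ G H Θ) →
    Derivable 𝒯 Γ (.eq (instSeq α s G P) (instSeq α s H Q) (T.instSeq G))

theorem SeqFunctional.base (n : ℕ) : SeqFunctional 𝒯 n .base := by
  intro s Γ Θ P Q T G H _ h _
  cases Θ; cases G; cases H
  cases T with
  | type => exact h
  | El A => exact h

/-- The first pair of abstractions is instantiated in two steps, `{G₁}P = {G₁}Q` and
`{G₁}Q = {H₁}Q`; the second one requires that `Q` is typable, which is where goodness enters. -/
theorem SeqFunctional.cons {n : ℕ} (hg : Good 𝒯 n) {γ δ : Arity} (h1 : Functional 𝒯 n γ)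
    (h2 : SeqFunctional 𝒯 n δ) : SeqFunctional 𝒯 n (.cons γ δ) := by
  intro s Γ Θ P Q T G H hs h hGH
  cases G with
  | cons G₁ G =>
  cases H with
  | cons H₁ H =>
  cases Θ with
  | cons K Θ =>
  obtain ⟨e1, e2⟩ := forall_seqEq_cons.1 hGH
  have hv : Derivable 𝒯 Γ .valid := e2 _ valid_mem_seqEq
  have hs' : Scope.order s ≤ n ∧ δ.order ≤ n ∧ γ.order ≤ n := by
    simp only [order_ext, Arity.order] at hs
    omega
  have hi := (InstCtx.single hv e1).append Θ
  have ho : Scope.order (TF.ext s δ) ≤ n := by rw [order_ext]; omega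
  have c1 := h1 h _ _ _ hs ho hi
  have c2 := h1 (hg.right hs h) _ _ _ hs ho hi
  have c := h2 ho (c1.trans c2) e2
  exact Eq.mp (congrArg (Derivable 𝒯 Γ) (congr (congrArg₂ Body.eq (instSeq_cons_eq G₁ G P).symm
    (instSeq_cons_eq H₁ H Q).symm) (BKind.instSeq_cons_eq G₁ G T).symm)) c

section Instantiation

variable {n : ℕ} {s t : Scope} {α β : Arity} {Γ : Ctx ar s} {Γ' : Ctx ar t} {σ τ : Inst ar α s t}

theorem absTyp_inst {F : Abs ar s β} {K : Kind ar s β}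
    (h : ∀ j ∈ absTyp Γ F K, FunctionalJ 𝒯 n α j) (hs : Scope.order s ≤ n)
    (ht : Scope.order t ≤ n) (hβ : β.order ≤ n) (hσ : InstCtx 𝒯 Γ Γ' σ τ) :
    Derives 𝒯 (absEq Γ' (Obj.inst (σ.ext β) F) (Obj.inst (τ.ext β) F) (K.inst σ)) := by
  cases K with
  | mk Δ T =>
    simp only [Kind.inst, Derives, forall_absEq]
    exact forall_absTyp.1 h _ _ _ (by simp only [order_ext]; omega)
      (by simp only [order_ext]; omega) (hσ.append Δ)

theorem absEq_inst {F G : Abs ar s β} {K : Kind ar s β}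
    (h : ∀ j ∈ absEq Γ F G K, FunctionalJ 𝒯 n α j) (hs : Scope.order s ≤ n)
    (ht : Scope.order t ≤ n) (hβ : β.order ≤ n) (hσ : InstCtx 𝒯 Γ Γ' σ τ) :
    Derives 𝒯 (absEq Γ' (Obj.inst (σ.ext β) F) (Obj.inst (σ.ext β) G) (K.inst σ)) := by
  cases K with
  | mk Δ T =>
    simp only [Kind.inst, Derives, forall_absEq]
    exact forall_absEq.1 h _ _ _ (by simp only [order_ext]; omega)
      (by simp only [order_ext]; omega) (hσ.append Δ)

theorem isKind_inst (hg : Good 𝒯 n) {K : Kind ar s β}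
    (h : ∀ j ∈ K.isKind Γ, FunctionalJ 𝒯 n α j) (hs : Scope.order s ≤ n)
    (ht : Scope.order t ≤ n) (hβ : β.order ≤ n) (hσ : InstCtx 𝒯 Γ Γ' σ τ) :
    Derives 𝒯 ((K.inst σ).isKind Γ') := by
  have hs' : Scope.order (TF.ext s β) ≤ n := by rw [order_ext]; omega
  have ht' : Scope.order (TF.ext t β) ≤ n := by rw [order_ext]; omega
  cases K with
  | mk Δ T =>
    cases T with
    | type =>
      simp only [Kind.inst, BKind.inst, Derives, forall_isKind_type]
      exact forall_isKind_type.1 h _ _ _ hs' ht' (hσ.append Δ)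
    | El A =>
      simp only [Kind.inst, BKind.inst, Derives, forall_isKind_El]
      exact hg.left ht' (forall_isKind_El.1 h _ _ _ hs' ht' (hσ.append Δ))

theorem seqTyp_inst {F : Args ar s β} {Δ : Tel ar s β}
    (h : ∀ j ∈ seqTyp Γ F Δ, FunctionalJ 𝒯 n α j) (hs : Scope.order s ≤ n)
    (ht : Scope.order t ≤ n) (hβ : β.order ≤ n + 1) (hσ : InstCtx 𝒯 Γ Γ' σ τ) :
    Derives 𝒯 (seqEq Γ' (F.inst σ) (F.inst τ) (Δ.inst σ)) := by
  induction β with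
  | base =>
    cases F; cases Δ
    simp only [Args.inst_nil, Tel.inst, Derives, forall_seqEq_nil]
    exact forall_seqTyp_nil.1 h _ _ _ hs ht hσ
  | cons β γ _ ih =>
    cases F; cases Δ
    obtain ⟨h1, h2⟩ := forall_seqTyp_cons.1 h
    simp only [Arity.order] at hβ
    simp only [Args.inst_cons, Tel.inst, Derives, forall_seqEq_cons]
    refine ⟨absTyp_inst h1 hs ht (by omega) hσ, ?_⟩
    rw [← Tel.inst_single_inst]
    exact ih h2 (by omega)

theorem seqEq_inst {F G : Args ar s β} {Δ : Tel ar s β}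
    (h : ∀ j ∈ seqEq Γ F G Δ, FunctionalJ 𝒯 n α j) (hs : Scope.order s ≤ n)
    (ht : Scope.order t ≤ n) (hβ : β.order ≤ n + 1) (hσ : InstCtx 𝒯 Γ Γ' σ τ) :
    Derives 𝒯 (seqEq Γ' (F.inst σ) (G.inst σ) (Δ.inst σ)) := by
  induction β with
  | base =>
    cases F; cases G; cases Δ
    simp only [Args.inst_nil, Tel.inst, Derives, forall_seqEq_nil]
    exact forall_seqEq_nil.1 h _ _ _ hs ht hσ
  | cons β γ _ ih =>
    cases F; cases G; cases Δ
    obtain ⟨h1, h2⟩ := forall_seqEq_cons.1 h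
    simp only [Arity.order] at hβ
    simp only [Args.inst_cons, Tel.inst, Derives, forall_seqEq_cons]
    refine ⟨absEq_inst h1 hs ht (by omega) hσ, ?_⟩
    rw [← Tel.inst_single_inst]
    exact ih h2 (by omega)

/-- An object with a variable as its head: if the variable is kept, the rule for variables applies,
and if it is replaced, functionality for its sequence of arguments does. -/
theorem Img.Related.app_eq (hf : SeqFunctional 𝒯 n α) {Δ : Tel ar t β}
    {T : BKind ar (TF.ext t β)} {i j : Img ar α t β} (ho : Scope.order (TF.ext t β) ≤ n)
    (h : Img.Related 𝒯 Γ' (.mk Δ T) i j) {F G : Args ar t β}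
    (hFG : Derives 𝒯 (seqEq Γ' F G Δ)) :
    Derivable 𝒯 Γ' (.eq (i.app (instSeq α t) F) (j.app (instSeq α t) G) (T.instSeq F)) := by
  cases h with
  | keep hy => exact .var_eq hy hFG
  | repl h => exact hf ho (forall_absEq.1 h) hFG

end Instantiation

theorem SeqFunctional.functional {n : ℕ} (hg : Good 𝒯 n) (hord : ∀ δ ∈ 𝒯, δ.order ≤ n + 1)
    {α : Arity} (hf : SeqFunctional 𝒯 n α) : Functional 𝒯 n α := by
  have hclosed {β : Arity} {s t : Scope} (σ : Inst ar α s t) (Δ : Tel ar [] β)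
      (T : BKind ar (TF.ext [] β)) :
      (Δ.rename (Ren.closed s)).inst σ = Δ.rename (Ren.closed t) ∧
      (T.rename ((Ren.closed s).ext β)).inst (σ.ext β) = T.rename ((Ren.closed t).ext β) := by
    have h := Kind.rename_closed_inst σ (.mk Δ T)
    simpa only [Kind.rename, Kind.inst, Kind.mk.injEq] using h
  intro s Γ J h
  induction h with
  | emp_ctxt =>
    intro t Γ' σ τ _ _ hσ
    cases hσ with
    | base h _ => exact h
  | ctxt _ ih =>
    intro t Γ' σ τ hs ht hσ
    cases hσ with
    | base h _ => exact h
    | snoc K hσ =>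
      simp only [Scope.order] at hs ht
      exact .ctxt (isKind_inst hg ih (by omega) (by omega) (by omega) hσ)
  | @var s β Γ x Δ T F hx _ ih =>
    intro t Γ' σ τ hs ht hσ
    have hβ := x.order_lt
    have hv : Derivable 𝒯 Γ' .valid := ih _ valid_mem_seqTyp _ _ _ hs ht hσ
    have hr := hσ.related hv β x
    simp only [hx, Kind.inst] at hr
    simp only [Body.inst₂, BKind.instSeq_inst, Obj.inst_var]
    exact hr.app_eq hf (by simp only [order_ext] at *; omega)
      (seqTyp_inst ih hs ht (by simp only at *; omega) hσ)
  | @var_eq s β Γ x Δ T F G hx _ ih =>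
    intro t Γ' σ τ hs ht hσ
    have hβ := x.order_lt
    have hσ' := hσ.refl_left hg hs ht
    have hv : Derivable 𝒯 Γ' .valid := ih _ valid_mem_seqEq _ _ _ hs ht hσ
    have hr := hσ'.related hv β x
    simp only [hx, Kind.inst] at hr
    simp only [Body.inst₂, BKind.instSeq_inst, Obj.inst_var]
    exact hr.app_eq hf (by simp only [order_ext] at *; omega)
      (seqEq_inst ih hs ht (by simp only at *; omega) hσ)
  | ref _ ih =>
    intro t Γ' σ τ hs ht hσ
    exact ih _ _ _ hs ht (hσ.refl_left hg hs ht)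
  | sym _ ih => intro t Γ' σ τ hs ht hσ; exact .sym (ih _ _ _ hs ht hσ)
  | trans _ _ ih ih' =>
    intro t Γ' σ τ hs ht hσ
    exact .trans (ih _ _ _ hs ht hσ) (ih' _ _ _ hs ht hσ)
  | conv _ _ ih ih' =>
    intro t Γ' σ τ hs ht hσ
    exact .conv_eq (ih _ _ _ hs ht hσ) (ih' _ _ _ hs ht hσ)
  | conv_eq _ _ ih ih' =>
    intro t Γ' σ τ hs ht hσ
    exact .conv_eq (ih _ _ _ hs ht hσ) (ih' _ _ _ hs ht hσ)
  | @const s Γ c Δ T F hc _ ih =>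
    intro t Γ' σ τ hs ht hσ
    have h := seqTyp_inst ih hs ht (hord _ hc) hσ
    obtain ⟨h1, h2⟩ := hclosed σ Δ T
    simp only [Body.inst₂, BKind.instSeq_inst, Obj.inst_const, h2]
    rw [h1] at h
    exact .const_eq hc h
  | @const_eq s Γ c Δ T F G hc _ ih =>
    intro t Γ' σ τ hs ht hσ
    have h := seqEq_inst ih hs ht (hord _ hc) hσ
    obtain ⟨h1, h2⟩ := hclosed σ Δ T
    simp only [Body.inst₂, BKind.instSeq_inst, Obj.inst_const, h2]
    rw [h1] at h
    exact .const_eq hc h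
  | @eq s Γ β Δ M N T F hc _ ih =>
    intro t Γ' σ τ hs ht hσ
    have h := hg.seqTyp_left ht (hord _ hc) (seqTyp_inst ih hs ht (hord _ hc) hσ)
    obtain ⟨h1, h2⟩ := hclosed σ Δ T
    simp only [Body.inst₂, BKind.instSeq_inst, instInstSeq β α σ, h2, Obj.rename_closed_inst]
    rw [h1] at h
    exact .eq hc h

theorem seqFunctional {n : ℕ} (hg : Good 𝒯 n) (hord : ∀ δ ∈ 𝒯, δ.order ≤ n + 1) (α : Arity) :
    SeqFunctional 𝒯 n α := by
  induction α with
  | base => exact SeqFunctional.base n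
  | cons γ δ ihγ ihδ => exact SeqFunctional.cons hg (SeqFunctional.functional hg hord ihγ) ihδ

theorem functional {n : ℕ} (hg : Good 𝒯 n) (hord : ∀ δ ∈ 𝒯, δ.order ≤ n + 1) (α : Arity) :
    Functional 𝒯 n α :=
  SeqFunctional.functional hg hord (seqFunctional hg hord α)

/-- Cut along an instantiation: functionality along the pair `(σ, σ)`, with reflexive equations read
as typings. -/
theorem Derivable.inst {n : ℕ} (hg : Good 𝒯 n) (hord : ∀ δ ∈ 𝒯, δ.order ≤ n + 1) {α : Arity}
    {s t : Scope} {Γ : Ctx ar s} {Γ' : Ctx ar t} {σ : Inst ar α s t} {J : Body ar s}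
    (hs : Scope.order s ≤ n) (ht : Scope.order t ≤ n) (h : Derivable 𝒯 Γ J)
    (hσ : InstCtx 𝒯 Γ Γ' σ σ) : Derivable 𝒯 Γ' (J.inst σ) := by
  have h' := functional hg hord α h Γ' σ σ hs ht hσ
  cases J with
  | valid => exact h'
  | typ M T => exact hg.left ht h'
  | eq M N T => exact h'

/-! ### Instantiation and weakening of equations between kinds -/

theorem BKindEq.inst {n : ℕ} (hg : Good 𝒯 n) (hord : ∀ δ ∈ 𝒯, δ.order ≤ n + 1) {α : Arity}
    {s t : Scope} {Γ : Ctx ar s} {Γ' : Ctx ar t} {σ : Inst ar α s t} (hs : Scope.order s ≤ n)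
    (ht : Scope.order t ≤ n) (hσ : InstCtx 𝒯 Γ Γ' σ σ) {T U : BKind ar s}
    (h : BKindEq 𝒯 Γ T U) : BKindEq 𝒯 Γ' (T.inst σ) (U.inst σ) := by
  cases T <;> cases U <;> simp only [BKindEq, BKind.inst] at h ⊢
  · exact h.inst hg hord hs ht hσ
  · exact h.inst hg hord hs ht hσ

mutual
theorem KindEq.inst {n : ℕ} (hg : Good 𝒯 n) (hord : ∀ δ ∈ 𝒯, δ.order ≤ n + 1) :
    ∀ {α β : Arity} {s t : Scope} {Γ : Ctx ar s} {Γ' : Ctx ar t} {σ : Inst ar α s t}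
    (_ : Scope.order s ≤ n) (_ : Scope.order t ≤ n) (_ : β.order ≤ n) (_ : InstCtx 𝒯 Γ Γ' σ σ)
    (K L : Kind ar s β), KindEq 𝒯 Γ K L → KindEq 𝒯 Γ' (K.inst σ) (L.inst σ)
  | _, _, _, _, _, _, _, hs, ht, hβ, hσ, .mk Δ T, .mk Θ U, h => by
    simp only [KindEq, Kind.inst] at h ⊢
    exact ⟨⟨h.1.1.inst hg hord hs ht hσ, TelEq.inst hg hord hs ht hβ hσ Δ Θ h.1.2⟩,
      h.2.inst hg hord (by rw [order_ext]; omega) (by rw [order_ext]; omega) (hσ.append Δ)⟩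
theorem TelEq.inst {n : ℕ} (hg : Good 𝒯 n) (hord : ∀ δ ∈ 𝒯, δ.order ≤ n + 1) :
    ∀ {α β : Arity} {s t : Scope} {Γ : Ctx ar s} {Γ' : Ctx ar t} {σ : Inst ar α s t}
    (_ : Scope.order s ≤ n) (_ : Scope.order t ≤ n) (_ : β.order ≤ n) (_ : InstCtx 𝒯 Γ Γ' σ σ)
    (Δ Θ : Tel ar s β), TelEq 𝒯 Γ Δ Θ → TelEq 𝒯 Γ' (Δ.inst σ) (Θ.inst σ)
  | _, _, _, _, _, _, _, _, _, _, _, .nil, .nil, _ => by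
    simp only [Tel.inst, TelEq]
  | _, _, _, _, _, _, _, hs, ht, hβ, hσ, .cons K Δ, .cons L Θ, h => by
    simp only [TelEq, Tel.inst, Arity.order] at h hβ ⊢
    exact ⟨KindEq.inst hg hord hs ht (by omega) hσ K L h.1,
      TelEq.inst hg hord (by simp only [Scope.order]; omega) (by simp only [Scope.order]; omega)
        (by omega) (hσ.snoc K) Δ Θ h.2⟩
end

theorem KindEq.wk {n : ℕ} (hg : Good 𝒯 n) (hord : ∀ δ ∈ 𝒯, δ.order ≤ n + 1) {β γ : Arity}
    {s : Scope} {Γ : Ctx ar s} {M : Kind ar s γ} (hs : Scope.order (γ :: s) ≤ n)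
    (hβ : β.order ≤ n) (hv : Derivable 𝒯 (Γ.snoc M) .valid) {K L : Kind ar s β}
    (h : KindEq 𝒯 Γ K L) :
    KindEq 𝒯 (Γ.snoc M) (K.rename (Ren.wk γ)) (L.rename (Ren.wk γ)) := by
  have hσ : InstCtx 𝒯 Γ (Γ.snoc M) ((Ren.wk γ).toInst .base) ((Ren.wk γ).toInst .base) :=
    .base hv fun δ x => .keep (by rw [Kind.inst_toInst]; rfl)
  have hs' : Scope.order s ≤ n := by simp only [Scope.order] at hs; omega
  have := KindEq.inst hg hord hs' hs hβ hσ K L h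
  rwa [Kind.inst_toInst, Kind.inst_toInst] at this

/-- Equal base kinds stay equal when the variables are instantiated by a typed sequence. -/
theorem BKindEq.instSeq {n : ℕ} (hg : Good 𝒯 n) (hord : ∀ δ ∈ 𝒯, δ.order ≤ n + 1) {α : Arity}
    {s : Scope} {Γ : Ctx ar s} {Δ : Tel ar s α} {F : Args ar s α} {T U : BKind ar (TF.ext s α)}
    (hs : Scope.order (TF.ext s α) ≤ n) (hF : Derives 𝒯 (seqTyp Γ F Δ))
    (h : BKindEq 𝒯 (Γ.append Δ) T U) : BKindEq 𝒯 Γ (T.instSeq F) (U.instSeq F) := by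
  cases T <;> cases U <;> simp only [BKindEq, BKind.instSeq] at h ⊢
  · exact hF _ valid_mem_seqTyp
  · exact seqFunctional hg hord α hs h (seqEq_refl hF)

theorem BKindEq.conv {s : Scope} {Γ : Ctx ar s} {T U : BKind ar s} {M : Obj ar s}
    (h : BKindEq 𝒯 Γ T U) (hM : Derivable 𝒯 Γ (.typ M T)) : Derivable 𝒯 Γ (.typ M U) := by
  cases T <;> cases U <;> simp only [BKindEq] at h
  · exact hM
  · exact .conv hM h

theorem BKindEq.conv_eq {s : Scope} {Γ : Ctx ar s} {T U : BKind ar s} {M N : Obj ar s}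
    (h : BKindEq 𝒯 Γ T U) (hM : Derivable 𝒯 Γ (.eq M N T)) : Derivable 𝒯 Γ (.eq M N U) := by
  cases T <;> cases U <;> simp only [BKindEq] at h
  · exact hM
  · exact .conv_eq hM h

/-! ### Context conversion -/

/-- The pairs of contexts between which derivations are transported: the second one is valid, and
the two give each variable the same kind, or the variable has arity `α` and its kinds are equal; both
are followed by the same further entries. -/
inductive ConvCtx (𝒯 : Spec ar) (α : Arity) : {s : Scope} → Ctx ar s → Ctx ar s → Prop
  | base {s : Scope} {Γ Γ' : Ctx ar s} : Derivable 𝒯 Γ' .valid →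
      (∀ (β : Arity) (x : Var s β), Γ.lookup x = Γ'.lookup x ∨
        β = α ∧ KindEq 𝒯 Γ' (Γ.lookup x) (Γ'.lookup x)) → ConvCtx 𝒯 α Γ Γ'
  | snoc {s : Scope} {Γ Γ' : Ctx ar s} {γ : Arity} (K : Kind ar s γ) : ConvCtx 𝒯 α Γ Γ' →
      ConvCtx 𝒯 α (Γ.snoc K) (Γ'.snoc K)

theorem ConvCtx.lookup {n : ℕ} (hg : Good 𝒯 n) (hord : ∀ δ ∈ 𝒯, δ.order ≤ n + 1) {α : Arity}
    {s : Scope} {Γ Γ' : Ctx ar s} (hs : Scope.order s ≤ n) (h : ConvCtx 𝒯 α Γ Γ')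
    (hv : Derivable 𝒯 Γ' .valid) (β : Arity) (x : Var s β) :
    Γ.lookup x = Γ'.lookup x ∨ β = α ∧ KindEq 𝒯 Γ' (Γ.lookup x) (Γ'.lookup x) := by
  induction h with
  | base _ h => exact h β x
  | snoc K _ ih =>
    cases x with
    | here => exact .inl rfl
    | there x =>
      have hx := x.order_lt
      have hs' := hs
      simp only [Scope.order] at hs'
      rcases ih (by omega) hv.valid_of_snoc x with h | ⟨hα, h⟩
      · left
        simp only [Ctx.lookup, h]
      · right
        exact ⟨hα, h.wk hg hord hs (by omega) hv⟩

theorem ConvCtx.append {α γ : Arity} {s : Scope} {Γ Γ' : Ctx ar s} (h : ConvCtx 𝒯 α Γ Γ')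
    (Δ : Tel ar s γ) : ConvCtx 𝒯 α (Γ.append Δ) (Γ'.append Δ) := by
  induction γ generalizing s with
  | base => cases Δ; exact h
  | cons γ δ _ ih =>
    cases Δ with
    | cons K Δ => exact ih (h.snoc K) Δ

theorem ConvCtx.single {n : ℕ} (hg : Good 𝒯 n) (hord : ∀ δ ∈ 𝒯, δ.order ≤ n + 1) {α : Arity}
    {s : Scope} {Γ : Ctx ar s} {K K' : Kind ar s α} (hs : Scope.order (α :: s) ≤ n)
    (hv : Derivable 𝒯 (Γ.snoc K') .valid) (h : KindEq 𝒯 Γ K K') :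
    ConvCtx 𝒯 α (Γ.snoc K) (Γ.snoc K') := by
  refine .base hv fun β x => ?_
  cases x with
  | here =>
    have hs' := hs
    simp only [Scope.order] at hs'
    exact .inr ⟨rfl, h.wk hg hord hs (by omega) hv⟩
  | there x => exact .inl rfl

/-- Conversion of the context of one judgement, for kinds of arity `α`. -/
def ConvertibleJ (𝒯 : Spec ar) (n : ℕ) (α : Arity) (j : Judgement ar) : Prop :=
  ∀ Γ' : Ctx ar j.scope, Scope.order j.scope ≤ n → ConvCtx 𝒯 α j.ctx Γ' → Derivable 𝒯 Γ' j.body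

/-- Context conversion, for kinds of arity `α`. -/
def Conversion (𝒯 : Spec ar) (n : ℕ) (α : Arity) : Prop :=
  ∀ {s : Scope} {Γ : Ctx ar s} {J : Body ar s}, Derivable 𝒯 Γ J → ConvertibleJ 𝒯 n α ⟨Γ, J⟩

/-- Conversion of all entries of an `α`-ary end of the context. -/
def TelConversion (𝒯 : Spec ar) (n : ℕ) (α : Arity) : Prop :=
  ∀ {s : Scope} {Γ : Ctx ar s} {Θ Θ' : Tel ar s α} {J : Body ar (TF.ext s α)},
    Scope.order (TF.ext s α) ≤ n → TelEq 𝒯 Γ Θ Θ' → Derivable 𝒯 (Γ.append Θ) J →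
    Derivable 𝒯 (Γ.append Θ') J

/-- Conversion of the kinds of the members of equal `α`-ary sequences. -/
def SeqConversion (𝒯 : Spec ar) (n : ℕ) (α : Arity) : Prop :=
  ∀ {s : Scope} {Γ : Ctx ar s} {Θ Θ' : Tel ar s α} {F G : Args ar s α},
    Scope.order s ≤ n → α.order ≤ n → TelEq 𝒯 Γ Θ Θ' → Derives 𝒯 (seqEq Γ F G Θ) →
    Derives 𝒯 (seqEq Γ F G Θ')

section Transport

variable {n : ℕ} {s : Scope} {α β : Arity} {Γ Γ' : Ctx ar s}

theorem absTyp_convert {F : Abs ar s β} {K : Kind ar s β}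
    (h : ∀ j ∈ absTyp Γ F K, ConvertibleJ 𝒯 n α j) (hs : Scope.order s ≤ n) (hβ : β.order ≤ n)
    (hc : ConvCtx 𝒯 α Γ Γ') : Derives 𝒯 (absTyp Γ' F K) := by
  cases K with
  | mk Δ T =>
    exact forall_absTyp.2
      (forall_absTyp.1 h _ (by simp only [order_ext]; omega) (hc.append Δ))

theorem absEq_convert {F G : Abs ar s β} {K : Kind ar s β}
    (h : ∀ j ∈ absEq Γ F G K, ConvertibleJ 𝒯 n α j) (hs : Scope.order s ≤ n) (hβ : β.order ≤ n)
    (hc : ConvCtx 𝒯 α Γ Γ') : Derives 𝒯 (absEq Γ' F G K) := by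
  cases K with
  | mk Δ T =>
    exact forall_absEq.2
      (forall_absEq.1 h _ (by simp only [order_ext]; omega) (hc.append Δ))

theorem isKind_convert {K : Kind ar s β} (h : ∀ j ∈ K.isKind Γ, ConvertibleJ 𝒯 n α j)
    (hs : Scope.order s ≤ n) (hβ : β.order ≤ n) (hc : ConvCtx 𝒯 α Γ Γ') :
    Derives 𝒯 (K.isKind Γ') := by
  have hs' : Scope.order (TF.ext s β) ≤ n := by rw [order_ext]; omega
  cases K with
  | mk Δ T =>
    cases T with
    | type => exact forall_isKind_type.2 (forall_isKind_type.1 h _ hs' (hc.append Δ))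
    | El A => exact forall_isKind_El.2 (forall_isKind_El.1 h _ hs' (hc.append Δ))

theorem seqTyp_convert {F : Args ar s β} {Δ : Tel ar s β}
    (h : ∀ j ∈ seqTyp Γ F Δ, ConvertibleJ 𝒯 n α j) (hs : Scope.order s ≤ n)
    (hβ : β.order ≤ n + 1) (hc : ConvCtx 𝒯 α Γ Γ') : Derives 𝒯 (seqTyp Γ' F Δ) := by
  induction β with
  | base => cases F; cases Δ; exact forall_seqTyp_nil.2 (forall_seqTyp_nil.1 h _ hs hc)
  | cons β γ _ ih =>
    cases F; cases Δ
    obtain ⟨h1, h2⟩ := forall_seqTyp_cons.1 h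
    simp only [Arity.order] at hβ
    exact forall_seqTyp_cons.2 ⟨absTyp_convert h1 hs (by omega) hc, ih h2 (by omega)⟩

theorem seqEq_convert {F G : Args ar s β} {Δ : Tel ar s β}
    (h : ∀ j ∈ seqEq Γ F G Δ, ConvertibleJ 𝒯 n α j) (hs : Scope.order s ≤ n)
    (hβ : β.order ≤ n + 1) (hc : ConvCtx 𝒯 α Γ Γ') : Derives 𝒯 (seqEq Γ' F G Δ) := by
  induction β with
  | base => cases F; cases G; cases Δ; exact forall_seqEq_nil.2 (forall_seqEq_nil.1 h _ hs hc)
  | cons β γ _ ih =>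
    cases F; cases G; cases Δ
    obtain ⟨h1, h2⟩ := forall_seqEq_cons.1 h
    simp only [Arity.order] at hβ
    exact forall_seqEq_cons.2 ⟨absEq_convert h1 hs (by omega) hc, ih h2 (by omega)⟩

end Transport

/-- The rule for a converted variable yields a kind `{F⃗/Δ'}T'` where `{F⃗/Δ}T` is asked for; the two
are equal by functionality. -/
theorem SeqConversion.conversion {n : ℕ} (hg : Good 𝒯 n) (hord : ∀ δ ∈ 𝒯, δ.order ≤ n + 1)
    {α : Arity} (hc : SeqConversion 𝒯 n α) : Conversion 𝒯 n α := by
  have hsymm {s : Scope} {Γ : Ctx ar s} {T U : BKind ar s} (h : BKindEq 𝒯 Γ T U) :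
      BKindEq 𝒯 Γ U T := by
    cases T <;> cases U <;> simp only [BKindEq] at h ⊢
    · exact h
    · exact .sym h
  have hit {s : Scope} {Γ : Ctx ar s} {β : Arity} {x : Var s β} {Δ : Tel ar s β}
      {T : BKind ar (TF.ext s β)} {F G : Args ar s β} (hs : Scope.order s ≤ n) (hβ : β = α)
      (hk : KindEq 𝒯 Γ (.mk Δ T) (Γ.lookup x)) (hFG : Derives 𝒯 (seqEq Γ F G Δ)) :
      ∃ (Δ' : Tel ar s β) (T' : BKind ar (TF.ext s β)), Γ.lookup x = .mk Δ' T' ∧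
        Derives 𝒯 (seqEq Γ F G Δ') ∧ BKindEq 𝒯 Γ (T'.instSeq F) (T.instSeq F) := by
    have ho := x.order_lt
    have hs' : Scope.order (TF.ext s β) ≤ n := by rw [order_ext]; omega
    subst hβ
    cases hl : Γ.lookup x with
    | mk Δ' T' =>
      rw [hl] at hk
      simp only [KindEq] at hk
      have hF := hg.seqTyp_left hs (by omega) hFG
      exact ⟨Δ', T', rfl, hc hs (by omega) hk.1.2 hFG, hsymm (hk.2.instSeq hg hord hs' hF)⟩
  intro s Γ J h
  induction h with
  | emp_ctxt =>
    intro Γ' _ hΓ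
    cases hΓ with
    | base h _ => exact h
  | ctxt _ ih =>
    intro Γ' hs hΓ
    cases hΓ with
    | base h _ => exact h
    | snoc K hΓ =>
      simp only [Scope.order] at hs
      exact .ctxt (isKind_convert ih (by omega) (by omega) hΓ)
  | @var s β Γ x Δ T F hx _ ih =>
    intro Γ' hs hΓ
    have hβ : β.order ≤ n := x.order_lt.le.trans hs
    have hF := seqTyp_convert ih hs (by omega) hΓ
    rcases hΓ.lookup hg hord hs (hF _ valid_mem_seqTyp) β x with hl | ⟨hα, hk⟩
    · exact .var (hl.symm.trans hx) hF
    · obtain ⟨Δ', T', hl, hF', hT⟩ := hit hs hα (hx ▸ hk) (seqEq_refl hF)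
      exact hT.conv (.var hl (hg.seqTyp_left hs (by omega) hF'))
  | @var_eq s β Γ x Δ T F G hx _ ih =>
    intro Γ' hs hΓ
    have hβ : β.order ≤ n := x.order_lt.le.trans hs
    have hF := seqEq_convert ih hs (by omega) hΓ
    rcases hΓ.lookup hg hord hs (hF _ valid_mem_seqEq) β x with hl | ⟨hα, hk⟩
    · exact .var_eq (hl.symm.trans hx) hF
    · obtain ⟨Δ', T', hl, hF', hT⟩ := hit hs hα (hx ▸ hk) hF
      exact hT.conv_eq (.var_eq hl hF')
  | ref _ ih => intro Γ' hs hΓ; exact .ref (ih _ hs hΓ)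
  | sym _ ih => intro Γ' hs hΓ; exact .sym (ih _ hs hΓ)
  | trans _ _ ih ih' => intro Γ' hs hΓ; exact .trans (ih _ hs hΓ) (ih' _ hs hΓ)
  | conv _ _ ih ih' => intro Γ' hs hΓ; exact .conv (ih _ hs hΓ) (ih' _ hs hΓ)
  | conv_eq _ _ ih ih' => intro Γ' hs hΓ; exact .conv_eq (ih _ hs hΓ) (ih' _ hs hΓ)
  | const hd _ ih => intro Γ' hs hΓ; exact .const hd (seqTyp_convert ih hs (hord _ hd) hΓ)
  | const_eq hd _ ih => intro Γ' hs hΓ; exact .const_eq hd (seqEq_convert ih hs (hord _ hd) hΓ)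
  | eq hd _ ih => intro Γ' hs hΓ; exact .eq hd (seqTyp_convert ih hs (hord _ hd) hΓ)

theorem BKindEq.convert {n : ℕ} {α : Arity} (hc : Conversion 𝒯 n α) {s : Scope}
    {Γ Γ' : Ctx ar s} (hs : Scope.order s ≤ n) (hΓ : ConvCtx 𝒯 α Γ Γ') {T U : BKind ar s}
    (h : BKindEq 𝒯 Γ T U) : BKindEq 𝒯 Γ' T U := by
  cases T <;> cases U <;> simp only [BKindEq] at h ⊢
  · exact hc h _ hs hΓ
  · exact hc h _ hs hΓ

mutual
theorem KindEq.convert {n : ℕ} {α : Arity} (hc : Conversion 𝒯 n α) :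
    ∀ {β : Arity} {s : Scope} {Γ Γ' : Ctx ar s} (_ : Scope.order s ≤ n) (_ : β.order ≤ n)
    (_ : ConvCtx 𝒯 α Γ Γ') (K L : Kind ar s β), KindEq 𝒯 Γ K L → KindEq 𝒯 Γ' K L
  | _, _, _, _, hs, hβ, hΓ, .mk Δ T, .mk Θ U, h => by
    simp only [KindEq] at h ⊢
    exact ⟨⟨hc h.1.1 _ hs hΓ, TelEq.convert hc hs hβ hΓ Δ Θ h.1.2⟩,
      h.2.convert hc (by rw [order_ext]; omega) (hΓ.append Δ)⟩
theorem TelEq.convert {n : ℕ} {α : Arity} (hc : Conversion 𝒯 n α) :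
    ∀ {β : Arity} {s : Scope} {Γ Γ' : Ctx ar s} (_ : Scope.order s ≤ n) (_ : β.order ≤ n)
    (_ : ConvCtx 𝒯 α Γ Γ') (Δ Θ : Tel ar s β), TelEq 𝒯 Γ Δ Θ → TelEq 𝒯 Γ' Δ Θ
  | _, _, _, _, _, _, _, .nil, .nil, _ => by simp only [TelEq]
  | _, _, _, _, hs, hβ, hΓ, .cons K Δ, .cons L Θ, h => by
    simp only [TelEq, Arity.order] at h hβ ⊢
    exact ⟨KindEq.convert hc hs (by omega) hΓ K L h.1,
      TelEq.convert hc (by simp only [Scope.order]; omega) (by omega) (hΓ.snoc K) Δ Θ h.2⟩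
end

/-- The right-hand side of an equation between kinds is a kind. -/
theorem KindEq.valid_snoc_right {n : ℕ} (hg : Good 𝒯 n) {α : Arity} (hc : TelConversion 𝒯 n α)
    {s : Scope} {Γ : Ctx ar s} {K K' : Kind ar s α} (hs : Scope.order (TF.ext s α) ≤ n)
    (h : KindEq 𝒯 Γ K K') : Derivable 𝒯 (Γ.snoc K') .valid := by
  cases K with
  | mk Δ T =>
    cases K' with
    | mk Δ' T' =>
      simp only [KindEq] at h
      refine .ctxt ?_
      obtain ⟨⟨_, h1⟩, h2⟩ := h
      cases T <;> cases T' <;> simp only [BKindEq] at h2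
      · exact forall_isKind_type.2 (hc hs h1 h2)
      · exact forall_isKind_El.2 (hc hs h1 (hg.right hs h2))

theorem TelConversion.cons {n : ℕ} (hg : Good 𝒯 n) (hord : ∀ δ ∈ 𝒯, δ.order ≤ n + 1)
    {γ δ : Arity} (h1 : TelConversion 𝒯 n γ) (h2 : Conversion 𝒯 n γ)
    (h3 : TelConversion 𝒯 n δ) : TelConversion 𝒯 n (.cons γ δ) := by
  intro s Γ Θ Θ' J hs he hJ
  cases Θ with
  | cons K Θ =>
  cases Θ' with
  | cons K' Θ' =>
  simp only [TelEq] at he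
  have hs' := hs
  simp only [order_ext, Arity.order] at hs'
  have hs1 : Scope.order (γ :: s) ≤ n := by simp only [Scope.order]; omega
  have hv := he.1.valid_snoc_right hg h1 (by rw [order_ext]; omega)
  have hΓ := ConvCtx.single hg hord hs1 hv he.1
  exact h3 hs (TelEq.convert h2 hs1 (by omega) hΓ _ _ he.2) (h2 hJ _ hs (hΓ.append Θ))

theorem SeqConversion.cons {n : ℕ} (hg : Good 𝒯 n) (hord : ∀ δ ∈ 𝒯, δ.order ≤ n + 1)
    {γ δ : Arity} (h1 : TelConversion 𝒯 n γ) (h2 : SeqConversion 𝒯 n δ) :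
    SeqConversion 𝒯 n (.cons γ δ) := by
  intro s Γ Θ Θ' F G hs hα he h
  cases Θ with
  | cons K Θ =>
  cases Θ' with
  | cons K' Θ' =>
  cases F with
  | cons F₁ F =>
  cases G with
  | cons G₁ G =>
  simp only [TelEq, Arity.order] at he hα
  obtain ⟨e1, e2⟩ := forall_seqEq_cons.1 h
  have hs1 : Scope.order (γ :: s) ≤ n := by simp only [Scope.order]; omega
  have hσ := (InstCtx.single (e2 _ valid_mem_seqEq) e1).refl_left hg hs1 hs
  refine forall_seqEq_cons.2 ⟨?_, h2 hs (by omega)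
    (TelEq.inst hg hord hs1 hs (by omega) hσ _ _ he.2) e2⟩
  cases K with
  | mk Ξ T =>
  cases K' with
  | mk Ξ' T' =>
  have hk := he.1
  simp only [KindEq] at hk
  exact forall_absEq.2
    (h1 (by rw [order_ext]; omega) hk.1.2 (hk.2.conv_eq (forall_absEq.1 e1)))

theorem telConversion_and_seqConversion {n : ℕ} (hg : Good 𝒯 n)
    (hord : ∀ δ ∈ 𝒯, δ.order ≤ n + 1) (α : Arity) :
    TelConversion 𝒯 n α ∧ SeqConversion 𝒯 n α := by
  induction α with
  | base =>
    constructor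
    · intro s Γ Θ Θ' J _ _ h
      cases Θ; cases Θ'
      exact h
    · intro s Γ Θ Θ' F G _ _ _ h
      cases Θ; cases Θ'
      exact h
  | cons γ δ ihγ ihδ =>
    exact ⟨TelConversion.cons hg hord ihγ.1 (SeqConversion.conversion hg hord ihγ.2) ihδ.1,
      SeqConversion.cons hg hord ihγ.1 ihδ.2⟩

end TF

theorem theorem3 {C : Type*} (ar : C → TF.Arity) (𝒯 : TF.Spec ar) (n : ℕ) (hgood : TF.Good 𝒯 n)
    (hord : ∀ δ ∈ 𝒯, δ.order ≤ n + 1)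
    {s : TF.Scope} {α β : TF.Arity} (Γ : TF.Ctx ar s) (K : TF.Kind ar s α)
    (Δ : TF.Tel ar (α :: s) β) (hctx : ((Γ.snoc K).append Δ).order ≤ n) :
    (∀ (J : TF.Body ar (TF.ext (α :: s) β)) (F : TF.Abs ar s α),
      TF.Derivable 𝒯 ((Γ.snoc K).append Δ) J →
      TF.Derives 𝒯 (TF.absTyp Γ F K) →
      TF.Derivable 𝒯 (Γ.append (Δ.inst (TF.Inst.single F)))
        (J.inst ((TF.Inst.single F).ext β))) ∧
    (∀ (M : TF.Obj ar (TF.ext (α :: s) β)) (T : TF.BKind ar (TF.ext (α :: s) β))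
        (F G : TF.Abs ar s α),
      TF.Derivable 𝒯 ((Γ.snoc K).append Δ) (.typ M T) →
      TF.Derives 𝒯 (TF.absEq Γ F G K) →
      TF.Derivable 𝒯 (Γ.append (Δ.inst (TF.Inst.single F)))
        (.eq (M.inst ((TF.Inst.single F).ext β)) (M.inst ((TF.Inst.single G).ext β))
          (T.inst ((TF.Inst.single F).ext β)))) ∧
    (∀ (J : TF.Body ar (TF.ext (α :: s) β)) (K' : TF.Kind ar s α),
      TF.Derivable 𝒯 ((Γ.snoc K).append Δ) J →
      TF.KindEq 𝒯 Γ K K' →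
      TF.Derivable 𝒯 ((Γ.snoc K').append Δ) J) := by
  have hs : TF.Scope.order (TF.ext (α :: s) β) ≤ n := hctx
  have hs' := hs
  simp only [TF.order_ext, TF.Scope.order] at hs'
  have ht : TF.Scope.order (TF.ext s β) ≤ n := by rw [TF.order_ext]; omega
  have hv {J : TF.Body ar (TF.ext (α :: s) β)}
      (h : TF.Derivable 𝒯 ((Γ.snoc K).append Δ) J) : TF.Derivable 𝒯 Γ .valid :=
    (Δ.valid_of_append h.valid).valid_of_snoc
  refine ⟨fun J F hJ hF => ?_, fun M T F G hM hFG => ?_, fun J K' hJ hK => ?_⟩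
  · exact hJ.inst hgood hord hs ht ((TF.InstCtx.single (hv hJ) (TF.absEq_refl hF)).append Δ)
  · exact TF.functional hgood hord α hM _ _ _ hs ht ((TF.InstCtx.single (hv hM) hFG).append Δ)
  · obtain ⟨h1, h2⟩ := TF.telConversion_and_seqConversion hgood hord α
    have hv' := hK.valid_snoc_right hgood h1 (by rw [TF.order_ext]; omega)
    exact TF.SeqConversion.conversion hgood hord h2 hJ _ hs
      ((TF.ConvCtx.single hgood hord (by simp only [TF.Scope.order]; omega) hv' hK).append Δ)
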